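/- Let $\Omega\in\mathbb R^{p\times p}$ be positive definite, let $n\ge 2p$, and let $X_1,\dots,X_n$ be i.i.d. $\mathcal N_p(0,\Omega^{-1})$, forming the rows of the data matrix $\boldsymbol X\in\mathbb R^{n\times p}$. Let $G=([p],E)$ be the undirected graph in which $i\ne j$ are adjacent if and only if the coordinates $i$ and $j$ of $\mathcal N_p(0,\Omega^{-1})$ are conditionally dependent given all the other coordinates. Edges are unordered pairs and $|\cdot|$ counts them. Let $q\in[0,1]$ and $(a,c_a)\in\{(1,1.93),(0.01,102)\}$. *Feature statistics.* For each $i\in[p]$ let $D$ be the $n\times(p-1)$ matrix of the columns of $\boldsymbol X$ other than the $i$th column $\boldsymbol X^{(i)}$, either as they are or rescaled to Euclidean length $1$ (the same option for all $i$). Let $\widetilde D$ be a function of $D$ alone such that, whenever $D^TD$ is invertible, $\widetilde D = D\,(I-(D^TD)^{-1}\mathrm{diag}(s))+UC$ with $U\in\mathbb R^{n\times(p-1)}$, $U^TU=I$, $D^TU=0$, $C^TC=2\,\mathrm{diag}(s)-\mathrm{diag}(s)(D^TD)^{-1}\mathrm{diag}(s)$. Here, with the same option for all $i$, either all $s_j=\min(2\lambda_{\min}(D^TD),1)$,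 or $s$ minimizes $\sum_j(1-s_j)$ subject to $\mathrm{diag}(s)\preceq 2D^TD$ and $0\le s_j\le 1$. Let $(W^{(i)}_j)_{j\ne i}=\mathcal P_i(D,\widetilde D,\boldsymbol X^{(i)})$, where $\mathcal P_i(D,\widetilde D,y)$ depends only on $[D\ \widetilde D]^T[D\ \widetilde D]$ and $[D\ \widetilde D]^Ty$ (sufficiency), and where swapping the $j$th columns of $D$ and $\widetilde D$ for all $j$ in a set $K$ changes the sign of the $j$th statistic for $j\in K$ and leaves the others unchanged (antisymmetry). Both properties are required only for pairs with $D^TD$ invertible, $\widetilde D^T\widetilde D=D^TD$ and $D^T\widetilde D=D^TD-\mathrm{diag}(s)$ for some $s\ge0$. Assume that $W^{(i)}$ is a measurable function of the data matrix, and set $W^{(i)}_i=0$. *Thresholds and estimated graph.* For $T\in(0,\infty]^p$ put $\widehat V_i^{+}(T_i)=\{j:W^{(i)}_j\ge T_i\}$ and $\widehat V_i^{-}(T_i)=\{j:W^{(i)}_j\le -T_i\}$. Let $\widehat E_{\mathrm{AND}}(T)$ (respectively $\widehat E_{\mathrm{OR}}(T)$) be the set of pairs $\{i,j\}$, $i\neq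 j$, with $j\in\widehat V_i^+(T_i)$ and (respectively or) $i\in\widehat V_j^+(T_j)$. For the rule $\mathcal R\in\{\mathrm{AND},\mathrm{OR}\}$ let $r_{\mathrm{AND}}=2q/(c_ap)$, $m_{\mathrm{AND}}=\lfloor q(p-1)/c_a\rfloor$, $r_{\mathrm{OR}}=q/(c_ap)$, $m_{\mathrm{OR}}=\lfloor q(p-1)/(2c_a)\rfloor$. For $m=m_{\mathcal R},m_{\mathcal R}-1,\dots,0$ consider the vector $T^{m}$ with $$T^{m}_i=\min\big\{t\in(\{|W^{(i)}_j|:j\in[p]\}\cup\{+\infty\})\setminus\{0\}:\ |\widehat V_i^-(t)|\le m\big\}.$$ Let $\widehat T$ be the first of these vectors that satisfies $$\frac{|\widehat V_i^-(T_i)|}{|\widehat E_{\mathcal R}(T)|\vee 1}\le r_{\mathcal R}\qquad\text{for all } i\in[p],$$ and $\widehat T=(+\infty,\dots,+\infty)$ if there is none. Put $\widehat E_{\mathcal R}=\widehat E_{\mathcal R}(\widehat T)$ and $\widehat F_{\mathcal R}=\widehat E_{\mathcal R}\setminus E$. Then $$\mathbb E\left[\frac{|\widehat F_{\mathrm{AND}}|}{|\widehat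 E_{\mathrm{AND}}|+a c_a p/(2q)}\right]\le q\qquad\text{and}\qquad \mathbb E\left[\frac{|\widehat F_{\mathrm{OR}}|}{|\widehat E_{\mathrm{OR}}|+a c_a p/q}\right]\le q,$$ where for $q=0$ the summands $a c_a p/(2q)$ and $a c_a p/q$ are $+\infty$ and the ratios are $0$. -/

import Mathlib

open MeasureTheory ProbabilityTheory Matrix
open scoped ENNReal

noncomputable section

namespace GGMKnockoff

/-! ### The Gaussian graphical model -/

/-- Coordinates `i` and `j` are conditionally independent given the coordinates in `H`
under the law `μ` on `ℝ^p`. -/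
def CondIndepCoord {p : ℕ} (μ : Measure (EuclideanSpace ℝ (Fin p))) [IsFiniteMeasure μ]
    (H : Set (Fin p)) (i j : Fin p) : Prop :=
  CondIndepFun
    (MeasurableSpace.comap (fun (x : EuclideanSpace ℝ (Fin p)) (k : H) => x k) inferInstance)
    (Measurable.comap_le (by fun_prop))
    (fun x => x i) (fun x => x j) μ

theorem CondIndepCoord.symm {p : ℕ} {μ : Measure (EuclideanSpace ℝ (Fin p))} [IsFiniteMeasure μ]
    {H : Set (Fin p)} {i j : Fin p} (h : CondIndepCoord μ H i j) : CondIndepCoord μ H j i :=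
  CondIndepFun.symm h

/-- The undirected graph of `N_p(0, Ω⁻¹)`: `i` and `j` are adjacent iff `i ≠ j` and `X_i`, `X_j` are
conditionally dependent given all the other coordinates. -/
def trueGraph {p : ℕ} (Ω : Matrix (Fin p) (Fin p) ℝ) : SimpleGraph (Fin p) where
  Adj i j := i ≠ j ∧ ¬ CondIndepCoord (multivariateGaussian 0 Ω⁻¹) ({i, j}ᶜ : Set (Fin p)) i j
  symm := ⟨fun i j h => ⟨h.1.symm, fun h' => h.2 (by
    rw [Set.pair_comm i j]; exact h'.symm)⟩⟩
  loopless := ⟨fun _ h => h.1 rfl⟩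

/-- Number of edges, `(i, j)` and `(j, i)` being counted as one edge. -/
def numEdges {p : ℕ} (G : SimpleGraph (Fin p)) : ℕ := G.edgeSet.ncard

/-! ### Fixed-X knockoffs for a linear model -/

section Knockoffs

variable {n : ℕ} {ι : Type} [Fintype ι] [DecidableEq ι]

/-- The two strategies for the vector `s`. -/
inductive Strategy
  | equi
  | sdp

/-- The constraints `diag s ⪯ 2 XᵀX`, `0 ≤ s_j ≤ 1`. -/
def SDPFeasible (X : Matrix (Fin n) ι ℝ) (s : ι → ℝ) : Prop :=
  (2 • (Xᵀ * X) - diagonal s).PosSemidef ∧ ∀ j, 0 ≤ s j ∧ s j ≤ 1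

/-- `s` is a vector computed from the design matrix `X` by the given strategy:
either all entries are `min (2 λ_min(XᵀX)) 1`, or `s` minimizes `∑ (1 - s_j)` over
the feasible vectors. -/
def IsStrategyVector : Strategy → Matrix (Fin n) ι ℝ → (ι → ℝ) → Prop
  | .equi, X, s => ∀ j, s j = min (2 * sInf (spectrum ℝ (Xᵀ * X))) 1
  | .sdp, X, s => SDPFeasible X s ∧
      ∀ s', SDPFeasible X s' → ∑ j, (1 - s j) ≤ ∑ j, (1 - s' j)

/-- `Xt` is a knockoff matrix constructed from the design matrix `X`:
`Xt = X (I - (XᵀX)⁻¹ diag s) + U C`. -/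
def IsConstructedKnockoff (O : Strategy) (X Xt : Matrix (Fin n) ι ℝ) : Prop :=
  ∃ (s : ι → ℝ) (U : Matrix (Fin n) ι ℝ) (C : Matrix ι ι ℝ),
    IsStrategyVector O X s ∧
    Uᵀ * U = 1 ∧ Xᵀ * U = 0 ∧
    Cᵀ * C = 2 • diagonal s - diagonal s * (Xᵀ * X)⁻¹ * diagonal s ∧
    Xt = X * (1 - (Xᵀ * X)⁻¹ * diagonal s) + U * C

/-- `XᵀX` is invertible and `[X Xt]` has the Gram matrix required of a design matrix
with its knockoffs. -/
def IsKnockoffPair (X Xt : Matrix (Fin n) ι ℝ) : Prop :=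
  IsUnit (Xᵀ * X) ∧ ∃ s : ι → ℝ, (∀ j, 0 ≤ s j) ∧
    Xᵀ * Xt = Xᵀ * X - diagonal s ∧ Xtᵀ * Xt = Xᵀ * X

/-- A procedure producing feature statistics from `X`, `Xt` and the response `y`. -/
abbrev FeatureProcedure (n : ℕ) (ι : Type) : Type :=
  Matrix (Fin n) ι ℝ → Matrix (Fin n) ι ℝ → (Fin n → ℝ) → ι → ℝ

/-- Sufficiency: the statistics depend only on the Gram matrix `[X Xt]ᵀ[X Xt]` and on `[X Xt]ᵀ y`. -/
def FeatureProcedure.Sufficient (P : FeatureProcedure n ι) : Prop :=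
  ∀ (X Xt X' Xt' : Matrix (Fin n) ι ℝ) (y y' : Fin n → ℝ),
    IsKnockoffPair X Xt → IsKnockoffPair X' Xt' →
    (fromCols X Xt)ᵀ * fromCols X Xt = (fromCols X' Xt')ᵀ * fromCols X' Xt' →
    (fromCols X Xt)ᵀ *ᵥ y = (fromCols X' Xt')ᵀ *ᵥ y' →
    P X Xt y = P X' Xt' y'

/-- `X` with the columns in `K` replaced by those of `Y`. -/
def replaceCols (K : Finset ι) (X Y : Matrix (Fin n) ι ℝ) : Matrix (Fin n) ι ℝ :=
  Matrix.of fun k j => if j ∈ K then Y k j else X k j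

/-- Antisymmetry: swapping the columns `X_j` and `Xt_j` for `j ∈ K` switches the sign of `W_j`
for `j ∈ K` and leaves the other statistics unchanged. -/
def FeatureProcedure.Antisymmetric (P : FeatureProcedure n ι) : Prop :=
  ∀ (X Xt : Matrix (Fin n) ι ℝ) (y : Fin n → ℝ) (K : Finset ι), IsKnockoffPair X Xt →
    ∀ j, P (replaceCols K X Xt) (replaceCols K Xt X) y j =
      if j ∈ K then - P X Xt y j else P X Xt y j

/-- What is done to the columns of the design matrix beforehand: nothing, or
rescaling to Euclidean length one. -/
inductive ColumnScaling
  | raw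
  | unit

/-- The design matrix after the chosen column scaling. -/
def ColumnScaling.apply : ColumnScaling → Matrix (Fin n) ι ℝ → Matrix (Fin n) ι ℝ
  | .raw, X => X
  | .unit, X => Matrix.of fun k j => X k j / Real.sqrt (∑ l, X l j ^ 2)

end Knockoffs

/-! ### The feature statistic matrix -/

/-- Indices of the predictors in the regression of variable `i` on all the others. -/
abbrev Others {p : ℕ} (i : Fin p) : Type := {j : Fin p // j ≠ i}

/-- The feature statistics `W^(i)_j` of the data set `x` (rows `x k`): variable `i` is the response,
the other variables are the predictors, `knock i` maps their design matrix to a knockoff matrix, and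
`P i` computes the statistics. The convention `W^(i)_i = 0` is used. -/
def featureStat {n p : ℕ} (σ : ColumnScaling)
    (knock : ∀ i : Fin p, Matrix (Fin n) (Others i) ℝ → Matrix (Fin n) (Others i) ℝ)
    (P : ∀ i : Fin p, FeatureProcedure n (Others i))
    (x : Fin n → EuclideanSpace ℝ (Fin p)) (i j : Fin p) : ℝ :=
  let D : Matrix (Fin n) (Others i) ℝ := σ.apply (Matrix.of fun k l => x k l)
  if h : j ≠ i then P i D (knock i D) (fun k => x k i) ⟨j, h⟩ else 0

/-! ### Global thresholds and the estimated graph -/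

/-- The rule that combines estimated neighbourhoods to a graph. -/
inductive Rule
  | and
  | or

/-- `{j : w_j ≥ T}`. -/
def Vplus {p : ℕ} (w : Fin p → ℝ) (T : EReal) : Finset (Fin p) :=
  Finset.univ.filter fun j => T ≤ (w j : EReal)

/-- `{j : w_j ≤ -T}`. -/
def Vminus {p : ℕ} (w : Fin p → ℝ) (T : EReal) : Finset (Fin p) :=
  Finset.univ.filter fun j => (w j : EReal) ≤ -T

/-- The estimated graph for the threshold vector `T`; here `W i` is the vector `W^(i)`. -/
def estGraph {p : ℕ} (W : Fin p → Fin p → ℝ) (R : Rule) (T : Fin p → EReal) :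
    SimpleGraph (Fin p) :=
  match R with
  | .and =>
    { Adj := fun i j => i ≠ j ∧ (i ∈ Vplus (W j) (T j) ∧ j ∈ Vplus (W i) (T i))
      symm := ⟨fun _ _ h => ⟨h.1.symm, h.2.symm⟩⟩
      loopless := ⟨fun _ h => h.1 rfl⟩ }
  | .or =>
    { Adj := fun i j => i ≠ j ∧ (i ∈ Vplus (W j) (T j) ∨ j ∈ Vplus (W i) (T i))
      symm := ⟨fun _ _ h => ⟨h.1.symm, h.2.symm⟩⟩
      loopless := ⟨fun _ h => h.1 rfl⟩ }

/-- Candidate thresholds: `({|w_j|} ∪ {+∞}) \ {0}`. -/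
def candidates {p : ℕ} (w : Fin p → ℝ) : Finset EReal :=
  insert ⊤ (Finset.univ.image fun j => ((|w j| : ℝ) : EReal)) \ {0}

/-- The smallest candidate threshold `t` with `|{j : w_j ≤ -t}| ≤ m`
(the candidate `+∞` always qualifies). -/
def nodeThreshold {p : ℕ} (w : Fin p → ℝ) (m : ℕ) : EReal :=
  ((candidates w).filter fun t => (Vminus w t).card ≤ m).inf id

/-- The right-hand side of the constraints: `2q/(c p)` for AND and `q/(c p)` for OR. -/
def level (R : Rule) (p : ℕ) (q c : ℝ) : ℝ :=
  match R with
  | .and => 2 * q / (c * p)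
  | .or => q / (c * p)

/-- The constraints of the optimization problem. The offset `a` is present for `δ = 1` and
absent for `δ = 0`. -/
def Feasible {p : ℕ} (W : Fin p → Fin p → ℝ) (q δ a c : ℝ) (R : Rule) (T : Fin p → EReal) : Prop :=
  ∀ i, (a * δ + ((Vminus (W i) (T i)).card : ℝ)) / max (numEdges (estGraph W R T) : ℝ) 1
    ≤ level R p q c

/-- The largest value of `m` to be tried. -/
def mMax (p : ℕ) (q δ a c : ℝ) : Rule → ℤ
  | .and => ⌊q * ((p : ℝ) - 1) / c - a * δ⌋
  | .or => ⌊q * ((p : ℝ) - 1) / (2 * c) - a * δ⌋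

open Classical in
/-- Try `m, m - 1, …, 0` and return the first threshold vector that meets the constraints,
or `(+∞, …, +∞)` if there is none. -/
def searchThreshold {p : ℕ} (W : Fin p → Fin p → ℝ) (q δ a c : ℝ) (R : Rule) : ℕ → Fin p → EReal
  | 0 =>
    if Feasible W q δ a c R (fun i => nodeThreshold (W i) 0)
    then fun i => nodeThreshold (W i) 0
    else fun _ => ⊤
  | m + 1 =>
    if Feasible W q δ a c R (fun i => nodeThreshold (W i) (m + 1))
    then fun i => nodeThreshold (W i) (m + 1)
    else searchThreshold W q δ a c R m

/-- The data-dependent threshold vector. -/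
def thresholds {p : ℕ} (W : Fin p → Fin p → ℝ) (q δ a c : ℝ) (R : Rule) : Fin p → EReal :=
  if mMax p q δ a c R < 0 then fun _ => ⊤
  else searchThreshold W q δ a c R (mMax p q δ a c R).toNat

/-- The GGM knockoff filter: the graph estimated from the data set `x`. -/
def knockoffFilter {n p : ℕ} (q δ a c : ℝ) (σ : ColumnScaling)
    (knock : ∀ i : Fin p, Matrix (Fin n) (Others i) ℝ → Matrix (Fin n) (Others i) ℝ)
    (P : ∀ i : Fin p, FeatureProcedure n (Others i)) (R : Rule)
    (x : Fin n → EuclideanSpace ℝ (Fin p)) : SimpleGraph (Fin p) :=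
  let W := featureStat σ knock P x
  estGraph W R (thresholds W q δ a c R)

/-- The modified false discovery rate `E[ |Ê \ E| / (|Ê| + b) ]` with values in `[0, ∞]`;
the ratio is `0` for `b = ∞`. -/
def mFDR {S : Type*} [MeasurableSpace S] {p : ℕ} (μ : Measure S)
    (Ehat : S → SimpleGraph (Fin p)) (G : SimpleGraph (Fin p)) (b : ℝ≥0∞) : ℝ≥0∞ :=
  ∫⁻ ω, (numEdges (Ehat ω \ G) : ℝ≥0∞) / ((numEdges (Ehat ω) : ℝ≥0∞) + b) ∂μ

end GGMKnockoff

end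

/-! For a node `i` let `M_i` be the maximum, over all thresholds, of (number of null positives) /
(`a` + number of null negatives) in `W^(i)`, a null being some `j ≠ i` not adjacent to `i`. If the
estimated graph is nonempty, its thresholds meet the constraints, so `a + |V_i^-| ≤ r (|Ê| + a/r)`,
and node `i` selects at most `M_i r (|Ê| + a/r)` nulls. A false edge uses up two such selections
under AND and at least one under OR. Hence the ratio is at most `r ∑ M_i / 2`, respectively `r ∑
M_i`, pointwise (`ratio_le_sum_signRatio`). The offset `a/r` is the one in the theorem, and `E M_i ≤
c` gives the bound `q` in both cases. No relation between different nodes is needed.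

Why `E M_i ≤ c`: write column `i` as its regression on the other columns plus independent Gaussian
noise. For a null `j` the regression coefficient vanishes (`eq_zero_of_condIndepCoord`). The
reflection exchanging column `j` with its knockoff then fixes the regression part and preserves the
law of the noise, while sufficiency and antisymmetry turn it into a sign change of `W^(i)_j`
(`exists_isometry_flip`). So, given the other columns, sign changes of null statistics do not alter
the law of `W^(i)`, and one may average over all sign patterns (`lintegral_signRatio_le`).

What remains concerns fair coins, tossed in the order of decreasing `|W_j|`: the maximum of heads /
(1 + tails) has mean at most 1.93 (`sum_ratio_one_le`). This mean is the integral of the hitting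
probabilities, bounded by an exponential martingale and a finite computation. The case `a = 0.01`
follows by waiting for the first tail (`sum_ratio_hundredth_le_of_heads`). -/

noncomputable section

namespace GGMKnockoff

/-! ### Coin flips -/

section Coins

/-- Probability that, within the next `n` fair coin flips, the number of heads reaches `x` times
one plus the number of tails, when `α` heads and `β` tails have been seen already. -/
def hitProb (x : ℝ) : ℕ → ℕ → ℕ → ℝ
  | 0, α, β => if x * (β + 1) ≤ α then 1 else 0
  | n + 1, α, β => if x * (β + 1) ≤ α then 1
      else (hitProb x n (α + 1) β + hitProb x n α (β + 1)) / 2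

theorem hitProb_of_le {x : ℝ} {n α β : ℕ} (h : x * (β + 1) ≤ α) : hitProb x n α β = 1 := by
  cases n <;> simp [hitProb, h]

theorem hitProb_nonneg (x : ℝ) (n α β : ℕ) : 0 ≤ hitProb x n α β := by
  induction n generalizing α β with
  | zero => unfold hitProb; split_ifs <;> norm_num
  | succ n ih =>
    unfold hitProb
    split_ifs
    · norm_num
    · linarith [ih (α + 1) β, ih α (β + 1)]

theorem hitProb_le_one (x : ℝ) (n α β : ℕ) : hitProb x n α β ≤ 1 := by
  induction n generalizing α β with
  | zero => unfold hitProb; split_ifs <;> norm_num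
  | succ n ih =>
    unfold hitProb
    split_ifs
    · norm_num
    · linarith [ih (α + 1) β, ih α (β + 1)]

/-- The potential is a martingale for the fair coin, because `z` and `2 - z` average to `1`. Being
nonnegative, and at least `1` wherever the level is reached, it dominates the hitting probability.
-/
theorem hitProb_le_potential {x z : ℝ} (hz0 : 0 ≤ z) (hz2 : z ≤ 2)
    (h : ∀ α β : ℕ, x * (β + 1) ≤ α → 1 ≤ z ^ (β + 1) * (2 - z) ^ α) (n α β : ℕ) :
    hitProb x n α β ≤ z ^ (β + 1) * (2 - z) ^ α := by
  have hpos : ∀ α β : ℕ, 0 ≤ z ^ (β + 1) * (2 - z) ^ α := fun α β =>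
    mul_nonneg (pow_nonneg hz0 _) (pow_nonneg (by linarith) _)
  induction n generalizing α β with
  | zero =>
    unfold hitProb
    split_ifs with hx
    exacts [h _ _ hx, hpos _ _]
  | succ n ih =>
    unfold hitProb
    split_ifs with hx
    · exact h _ _ hx
    · have h1 := ih (α + 1) β
      have h2 := ih α (β + 1)
      have : z ^ (β + 1) * (2 - z) ^ (α + 1) + z ^ (β + 1 + 1) * (2 - z) ^ α
          = 2 * (z ^ (β + 1) * (2 - z) ^ α) := by ring
      linarith

/-- Reduces the condition on all hitting positions to a single inequality: compare `s`-th powers and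
use `2 - z ≥ 1` with `r (β + 1) ≤ α s`. -/
theorem one_le_potential {x z : ℝ} {r s : ℕ} (hs : 0 < s) (hx : x = r / s) (hz0 : 0 ≤ z)
    (hz1 : z ≤ 1) (h : 1 ≤ z ^ s * (2 - z) ^ r) (α β : ℕ) (hαβ : x * (β + 1) ≤ α) :
    1 ≤ z ^ (β + 1) * (2 - z) ^ α := by
  have hr : r * (β + 1) ≤ α * s := by
    have hs' : (0 : ℝ) < s := by exact_mod_cast hs
    rw [hx, div_mul_eq_mul_div, div_le_iff₀ hs'] at hαβ
    exact_mod_cast hαβ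
  have hb : 0 ≤ z ^ (β + 1) * (2 - z) ^ α :=
    mul_nonneg (pow_nonneg hz0 _) (pow_nonneg (by linarith) _)
  rw [← one_le_pow_iff_of_nonneg hb hs.ne']
  calc (1 : ℝ) ≤ (z ^ s * (2 - z) ^ r) ^ (β + 1) := one_le_pow₀ h
    _ = z ^ (s * (β + 1)) * (2 - z) ^ (r * (β + 1)) := by rw [mul_pow, ← pow_mul, ← pow_mul]
    _ ≤ z ^ (s * (β + 1)) * (2 - z) ^ (α * s) := by
        gcongr
        linarith
    _ = _ := by rw [mul_pow, ← pow_mul, ← pow_mul, mul_comm s]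

theorem hitProb_natCast_le {k : ℕ} (hk : 1 ≤ k) (n : ℕ) :
    hitProb k n 0 0 ≤ 2 * (1 / 2) ^ k := by
  have hk2 : k ≤ 2 ^ (k - 1) := by
    have := Nat.lt_two_pow_self (n := k - 1)
    omega
  set u : ℝ := (1 / 2) ^ k with hu
  have hu0 : 0 < u := by positivity
  have h2k : (2 : ℝ) ^ k * u = 1 := by rw [hu, ← mul_pow]; norm_num
  have hku : (k : ℝ) * u ≤ 1 / 2 := by
    have h1 : (k : ℝ) ≤ 2 ^ (k - 1) := by exact_mod_cast hk2
    have h3 : (2 : ℝ) ^ k = 2 ^ (k - 1) * 2 := by rw [← pow_succ]; congr 1; omega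
    nlinarith
  have hu1 : 2 * u ≤ 1 := by
    have : (1 : ℝ) ≤ k := by exact_mod_cast hk
    nlinarith
  -- The parameter `z = 2^(1-k)` is admissible: `z (2 - z)^k = 2 (1 - u)^k ≥ 2 (1 - k u) ≥ 1` by
  -- Bernoulli.
  have key := hitProb_le_potential (x := k) (z := 2 * u) (by positivity) (by linarith)
    (one_le_potential (r := k) (s := 1) one_pos (by simp) (by positivity) hu1 (by
      have hb := one_add_mul_le_pow (a := -u) (by linarith) k
      have : (2 - 2 * u) ^ k = 2 ^ k * (1 + -u) ^ k := by rw [← mul_pow]; congr 1; ring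
      rw [this, pow_one]
      have h5 : (1 : ℝ) / 2 ≤ (1 + -u) ^ k := by linarith
      calc (1 : ℝ) = 2 * ((2 : ℝ) ^ k * u) * (1 / 2) := by rw [h2k]; norm_num
        _ ≤ 2 * ((2 : ℝ) ^ k * u) * (1 + -u) ^ k := by gcongr
        _ = _ := by ring)) n 0 0
  simpa using key

/-! ### A computable bound for hitting probabilities -/

/-- `f x`, evaluated after `x`. -/
def force {A : Type} (x : ℕ) (f : ℕ → A) : A :=
  match x with
  | 0 => f 0
  | n + 1 => f (n + 1)

theorem force_eq {A : Type} (x : ℕ) (f : ℕ → A) : force x f = f x := by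
  cases x <;> rfl

/-- Terminal values `Z ^ (α + β + 1) * z ^ (β + 1) * (2 - z) ^ α` for `z = u / Z` along an
antidiagonal. -/
def terminalRow (u Z : ℕ) : ℕ → ℕ → List ℕ
  | α, 0 => [u * (2 * Z - u) ^ α]
  | α, β + 1 => force (u ^ (β + 2) * (2 * Z - u) ^ α) fun v => v :: terminalRow u Z (α + 1) β

/-- One step of the backward recursion for scaled hitting probabilities along an antidiagonal. -/
def backRow (r R S : ℕ) : ℕ → ℕ → List ℕ → List ℕ
  | α, 0, a :: b :: _ => [bif Nat.ble r (α * R) then S else a + b]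
  | α, β + 1, a :: b :: l =>
    force (bif Nat.ble (r * (β + 2)) (α * R) then S else a + b) fun v =>
      v :: backRow r R S (α + 1) β (b :: l)
  | _, _, l => l

/-- Backward recursion from level `k` to level `0`. -/
def backTo (r R : ℕ) : ℕ → ℕ → List ℕ → ℕ
  | 0, _, l => l.headD 0
  | k + 1, S, l => backTo r R k (2 * S) (backRow r R (2 * S) 0 k l)

/-- An upper bound for `Z ^ (K + 1) * 2 ^ K` times the probability of ever hitting `r / R`. -/
def hitBound (R Z K r u : ℕ) : ℕ :=
  backTo r R K (Z ^ (K + 1)) (terminalRow u Z 0 K)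

/-- The entries of the list are upper bounds for the scaled hitting probabilities. -/
def RowBounds (x S : ℝ) : ℕ → ℕ → List ℕ → Prop
  | _, _, [] => False
  | α, 0, a :: _ => ∀ n, hitProb x n α 0 * S ≤ a
  | α, β + 1, a :: l => (∀ n, hitProb x n α (β + 1) * S ≤ a) ∧ RowBounds x S (α + 1) β l

/-- The factor `Z ^ (α + β + 1)` clears all denominators of the potential and depends on `α + β`
only, so it is constant along an antidiagonal. -/
theorem rowBounds_terminalRow {x : ℝ} {u Z : ℕ} (hu : u ≤ 2 * Z) (hZ : 0 < Z)
    (h : ∀ n α β : ℕ, hitProb x n α β ≤ (u / Z : ℝ) ^ (β + 1) * (2 - u / Z) ^ α) (α β : ℕ) :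
    RowBounds x ((Z : ℝ) ^ (α + β + 1)) α β (terminalRow u Z α β) := by
  have hZ' : (0 : ℝ) < Z := by exact_mod_cast hZ
  have key : ∀ n α β : ℕ, hitProb x n α β * (Z : ℝ) ^ (α + β + 1)
      ≤ ((u ^ (β + 1) * (2 * Z - u) ^ α : ℕ) : ℝ) := by
    intro n α β
    calc hitProb x n α β * (Z : ℝ) ^ (α + β + 1)
        ≤ (u / Z : ℝ) ^ (β + 1) * (2 - u / Z) ^ α * (Z : ℝ) ^ (α + β + 1) := by
          gcongr
          exact h n α β
      _ = ((u / Z : ℝ) * Z) ^ (β + 1) * ((2 - u / Z) * Z) ^ α := by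
          rw [mul_pow, mul_pow]; ring
      _ = _ := by
          rw [div_mul_cancel₀ _ hZ'.ne', sub_mul, div_mul_cancel₀ _ hZ'.ne']
          push_cast [Nat.cast_sub hu]
          ring
  induction β generalizing α with
  | zero =>
    intro n
    have := key n α 0
    simpa [terminalRow] using this
  | succ β ih =>
    rw [terminalRow, force_eq]
    refine ⟨fun n => key n α (β + 1), ?_⟩
    have := ih (α + 1)
    rwa [show α + 1 + β + 1 = α + (β + 1) + 1 by ring] at this

/-- Doubling the scale absorbs the division by two in the recursion, which keeps the computation in
the integers. Bounds uniform in `n` spare any matching of horizons. -/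
theorem hitProb_mul_le {x S a b : ℝ} {α β : ℕ} (hx : ¬ x * (β + 1) ≤ α) (hS : 0 ≤ S)
    (ha : ∀ n, hitProb x n α (β + 1) * S ≤ a) (hb : ∀ n, hitProb x n (α + 1) β * S ≤ b) (n : ℕ) :
    hitProb x n α β * (2 * S) ≤ a + b := by
  cases n with
  | zero =>
    have h1 := (mul_nonneg (hitProb_nonneg x 0 α (β + 1)) hS).trans (ha 0)
    have h2 := (mul_nonneg (hitProb_nonneg x 0 (α + 1) β) hS).trans (hb 0)
    simp only [hitProb, hx, if_false]
    linarith
  | succ n =>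
    have h1 := ha n
    have h2 := hb n
    simp only [hitProb, hx, if_false]
    linarith

theorem hitProb_cell_le {x : ℝ} {r R : ℕ} (hR : 0 < R) (hx : x = r / R) {S a b α β : ℕ}
    (ha : ∀ n, hitProb x n α (β + 1) * S ≤ a) (hb : ∀ n, hitProb x n (α + 1) β * S ≤ b) (n : ℕ) :
    hitProb x n α β * ((2 * S : ℕ) : ℝ)
      ≤ ((bif Nat.ble (r * (β + 1)) (α * R) then 2 * S else a + b : ℕ) : ℝ) := by
  have hR' : (0 : ℝ) < R := by exact_mod_cast hR
  cases hc : Nat.ble (r * (β + 1)) (α * R) with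
  | true =>
    simp only [cond_true]
    exact mul_le_of_le_one_left (Nat.cast_nonneg _) (hitProb_le_one _ _ _ _)
  | false =>
    have hlt : ¬ r * (β + 1) ≤ α * R := fun h => by
      rw [Nat.ble_eq_true_of_le h] at hc
      cases hc
    have : ¬ x * (β + 1) ≤ α := by
      rw [hx, div_mul_eq_mul_div, div_le_iff₀ hR']
      exact_mod_cast hlt
    have := hitProb_mul_le this (Nat.cast_nonneg S) ha hb n
    simpa using this

theorem rowBounds_backRow {x : ℝ} {r R : ℕ} (hR : 0 < R) (hx : x = r / R) (S α β : ℕ)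
    (l : List ℕ) (h : RowBounds x S α (β + 1) l) :
    RowBounds x ((2 * S : ℕ) : ℝ) α β (backRow r R (2 * S) α β l) := by
  induction β generalizing α l with
  | zero =>
    match l, h with
    | [a], h => exact h.2.elim
    | a :: b :: l, h =>
      intro n
      have := hitProb_cell_le hR hx h.1 h.2 n
      simpa using this
  | succ β ih =>
    match l, h with
    | [a], h => exact h.2.elim
    | a :: b :: l, h =>
      rw [backRow, force_eq]
      exact ⟨fun n => hitProb_cell_le hR hx h.1 h.2.1 n, ih _ _ h.2⟩

theorem hitProb_le_backTo {x : ℝ} {r R : ℕ} (hR : 0 < R) (hx : x = r / R) (k S : ℕ)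
    (l : List ℕ) (h : RowBounds x S 0 k l) (n : ℕ) :
    hitProb x n 0 0 * ((2 ^ k * S : ℕ) : ℝ) ≤ backTo r R k S l := by
  induction k generalizing S l with
  | zero =>
    match l, h with
    | a :: l, h => simpa [backTo] using h n
  | succ k ih =>
    have := ih (2 * S) _ (rowBounds_backRow hR hx S 0 k l h)
    rwa [show 2 ^ k * (2 * S) = 2 ^ (k + 1) * S by ring] at this

/-- The first `K` tosses are treated exactly and the potential bounds what happens afterwards. This
is sharper than the potential alone, which overshoots `1` at most hitting positions. -/
theorem hitProb_le_hitBound {R Z K r u : ℕ} (hR : 0 < R) (hZ : 0 < Z) (hu : u ≤ Z)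
    (h : Z ^ (R + r) ≤ u ^ R * (2 * Z - u) ^ r) (n : ℕ) :
    hitProb (r / R) n 0 0 * ((2 ^ K * Z ^ (K + 1) : ℕ) : ℝ) ≤ hitBound R Z K r u := by
  have hZ' : (0 : ℝ) < Z := by exact_mod_cast hZ
  have hu' : (u : ℝ) ≤ Z := by exact_mod_cast hu
  have hz1 : (u / Z : ℝ) ≤ 1 := by rwa [div_le_one hZ']
  have hpot := one_le_potential (x := r / R) (z := u / Z) hR rfl (by positivity) hz1 (by
    have h' : (Z : ℝ) ^ (R + r) ≤ (u : ℝ) ^ R * (2 * Z - u) ^ r := by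
      have h2 : ((Z ^ (R + r) : ℕ) : ℝ) ≤ ((u ^ R * (2 * Z - u) ^ r : ℕ) : ℝ) := by
        exact_mod_cast h
      push_cast [Nat.cast_sub (show u ≤ 2 * Z by omega)] at h2
      exact h2
    have e : (2 - u / Z : ℝ) = (2 * Z - u) / Z := by field_simp
    rw [e, div_pow, div_pow, div_mul_div_comm, ← pow_add, one_le_div (by positivity)]
    exact h')
  have hb := hitProb_le_potential (by positivity) (by linarith) hpot
  refine hitProb_le_backTo hR rfl K _ _ ?_ n
  have := rowBounds_terminalRow (x := r / R) (by omega) hZ hb 0 K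
  simpa using this

end Coins

/-! ### Numerical bound for the integral of the hitting probability -/

section Grid

/-- A right endpoint sum, scaled by `R * Z ^ (K + 1) * 2 ^ K`, for the integral of the hitting
probability up to `X` over the grid of the points `r / R` with parameters `u / Z`. -/
def gridSum (R Z K X : ℕ) : List (ℕ × ℕ) → ℕ
  | [] => 0
  | [(r, u)] => (X * R - r) * hitBound R Z K r u
  | (r, u) :: (r', u') :: l =>
    (r' - r) * hitBound R Z K r u + gridSum R Z K X ((r', u') :: l)

/-- The grid points increase up to `X`, and the parameters are admissible. -/
def gridValid (R Z X : ℕ) : List (ℕ × ℕ) → Bool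
  | [] => true
  | [(r, u)] => Nat.ble r (X * R) && (Nat.ble u Z &&
      Nat.ble (Z ^ (R + r)) (u ^ R * (2 * Z - u) ^ r))
  | (r, u) :: (r', u') :: l => (Nat.ble r r' && (Nat.ble u Z &&
      Nat.ble (Z ^ (R + r)) (u ^ R * (2 * Z - u) ^ r))) && gridValid R Z X ((r', u') :: l)

/-- Grid points `r / 200` with parameters `u / 1001`. -/
def grid : List (ℕ × ℕ) :=
  [(200, 1001), (203, 987), (206, 972), (209, 957), (212, 943), (215, 929), (218, 915), (222,
   897), (226, 880), (230, 862), (234, 845), (237, 833), (241, 816), (246, 796), (251,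
   777), (258, 751), (262, 736), (267, 718), (271, 704), (276, 687), (281, 671), (286,
   655), (292, 636), (301, 609), (307, 591), (315, 569), (321, 553), (328, 535), (334,
   520), (343, 498), (351, 480), (361, 458), (372, 435), (381, 418), (401, 381), (429,
   336), (441, 318), (451, 305), (467, 284), (481, 267), (501, 245), (534, 213), (551,
   198), (567, 185), (601, 161), (667, 123), (701, 107), (734, 94), (801, 73), (901, 50), (1001,
   34), (1101, 24), (1201, 17), (1401, 9), (1601, 4), (1801, 2), (2001, 1), (2201, 1), (2401,
   1)]

theorem gridValid_grid : gridValid 200 1001 14 grid = true := by decide +kernel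

/-- The integral from `1` to `14` is at most `0.929`. Many grid points lie just beyond a simple
fraction (`401/200` beyond `2`, `267/200` beyond `4/3`), where the hitting probability drops.
`force` makes the kernel evaluate each entry before it is reused. -/
theorem gridSum_grid_le :
    1000 * gridSum 200 1001 30 14 grid ≤ 929 * (200 * (2 ^ 30 * 1001 ^ 31)) := by decide +kernel

variable {n : ℕ} {E : ℝ → ℝ}

/-- `E b` stands for the mean of `min M b`, whose growth from `a` to `b` is at most `(b - a) P(M ≥
a)`. Adding these increments over the grid replaces an integral by a finite sum. -/
theorem le_add_gridSum {R Z K X : ℕ} (hR : 0 < R) (hZ : 0 < Z)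
    (hE : ∀ a b, 0 ≤ a → a ≤ b → E b ≤ E a + (b - a) * hitProb a n 0 0)
    (r u : ℕ) (l : List (ℕ × ℕ)) (hl : gridValid R Z X ((r, u) :: l) = true) :
    E X ≤ E (r / R) + gridSum R Z K X ((r, u) :: l) / (R * ((2 ^ K * Z ^ (K + 1) : ℕ) : ℝ)) := by
  have hR' : (0 : ℝ) < R := by exact_mod_cast hR
  have hT : (0 : ℝ) < ((2 ^ K * Z ^ (K + 1) : ℕ) : ℝ) := by
    have : 0 < 2 ^ K * Z ^ (K + 1) := by positivity
    exact_mod_cast this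
  set T : ℝ := ((2 ^ K * Z ^ (K + 1) : ℕ) : ℝ) with hTdef
  have step : ∀ r r' u : ℕ, r ≤ r' → u ≤ Z → Z ^ (R + r) ≤ u ^ R * (2 * Z - u) ^ r →
      E (r' / R) ≤ E (r / R) + (((r' - r) * hitBound R Z K r u : ℕ) : ℝ) / (R * T) := by
    intro r r' u hr hu hp
    have h1 := hE (r / R) (r' / R) (by positivity) (by gcongr)
    have h2 := hitProb_le_hitBound (K := K) hR hZ hu hp n
    rw [← le_div_iff₀ hT] at h2
    have h3 : (r' / R - r / R : ℝ) * hitProb (r / R) n 0 0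
        ≤ (r' / R - r / R : ℝ) * (hitBound R Z K r u / T) := by
      apply mul_le_mul_of_nonneg_left h2
      rw [sub_nonneg]
      gcongr
    have h4 : (((r' - r) * hitBound R Z K r u : ℕ) : ℝ) / (R * T)
        = (r' / R - r / R : ℝ) * (hitBound R Z K r u / T) := by
      push_cast [Nat.cast_sub hr]
      field_simp
    linarith
  induction l generalizing r u with
  | nil =>
    simp only [gridValid, Bool.and_eq_true, Nat.ble_eq] at hl
    have := step r (X * R) u hl.1 hl.2.1 hl.2.2
    rwa [Nat.cast_mul, mul_div_cancel_right₀ _ hR'.ne'] at this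
  | cons a l ih =>
    obtain ⟨r', u'⟩ := a
    simp only [gridValid, Bool.and_eq_true, Nat.ble_eq] at hl
    have h1 := step r r' u hl.1.1 hl.1.2.1 hl.1.2.2
    have h2 := ih r' u' hl.2
    rw [gridSum, Nat.cast_add, add_div]
    linarith

/-- Three ranges: at most `1` on `[0, 1]`, at most `0.929` on `[1, 14]` from the grid, and at most
`4 / 2^14 < 0.001` beyond. -/
theorem le_of_hitProb_bound (h0 : E 0 ≤ 0)
    (hE : ∀ a b, 0 ≤ a → a ≤ b → E b ≤ E a + (b - a) * hitProb a n 0 0) (m : ℕ) :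
    E ((14 + m : ℕ) : ℝ) ≤ 1.93 := by
  have h1 : E 1 ≤ 1 := by
    have := hE 0 1 le_rfl zero_le_one
    have := hitProb_le_one 0 n 0 0
    linarith
  have h14 : E ((14 : ℕ) : ℝ) ≤ 1.929 := by
    have key := le_add_gridSum (K := 30) (R := 200) (Z := 1001) (X := 14) (by norm_num)
      (by norm_num) hE _ _ _ gridValid_grid
    have hb : ((1000 * gridSum 200 1001 30 14 grid : ℕ) : ℝ)
        ≤ ((929 * (200 * (2 ^ 30 * 1001 ^ 31)) : ℕ) : ℝ) := by exact_mod_cast gridSum_grid_le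
    have hb' : (gridSum 200 1001 30 14 grid : ℝ) / (((200 : ℕ) : ℝ) *
        ((2 ^ 30 * 1001 ^ (30 + 1) : ℕ) : ℝ)) ≤ 0.929 := by
      rw [div_le_iff₀ (by positivity)]
      push_cast at hb ⊢
      linarith
    rw [show (((200 : ℕ) : ℝ) / ((200 : ℕ) : ℝ)) = 1 by norm_num] at key
    have : E ((14 : ℕ) : ℝ) ≤ E 1 + 0.929 := key.trans (by gcongr; exact hb')
    linarith
  -- Unit steps with increments `2 / 2^k` form a geometric series, whose partial sums are written in
  -- closed form.
  have hm : E ((14 + m : ℕ) : ℝ) ≤ E ((14 : ℕ) : ℝ) + 4 * (1 / 2) ^ 14 * (1 - (1 / 2) ^ m) := by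
    induction m with
    | zero => simp
    | succ m ih =>
      have h2 := hE ((14 + m : ℕ) : ℝ) ((14 + (m + 1) : ℕ) : ℝ) (by positivity)
        (by push_cast; linarith)
      have h3 := hitProb_natCast_le (k := 14 + m) (by omega) n
      have h4 : (((14 + (m + 1) : ℕ) : ℝ) - ((14 + m : ℕ) : ℝ)) = 1 := by push_cast; ring
      rw [h4, one_mul] at h2
      have h5 : (2 : ℝ) * (1 / 2) ^ (14 + m) = 2 * (1 / 2) ^ 14 * (1 / 2) ^ m := by
        rw [pow_add]; ring
      rw [pow_succ _ m]
      linarith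
  have h6 : (0 : ℝ) ≤ (1 / 2) ^ m := by positivity
  have h7 : (4 : ℝ) * (1 / 2) ^ 14 * (1 - (1 / 2) ^ m) ≤ 4 * (1 / 2) ^ 14 * 1 := by
    gcongr
    linarith
  norm_num at h7 hm ⊢
  linarith

end Grid

/-! ### Random signs as coin tosses -/

section SignFlips

variable {ι : Type*}

/-- Number of `k ∈ H` with `w k ≥ t`. -/
def posCount (H : Finset ι) (w : ι → ℝ) (t : ℝ) : ℕ := (H.filter fun k => t ≤ w k).card

/-- Number of `k ∈ H` with `w k ≤ -t`. -/
def negCount (H : Finset ι) (w : ι → ℝ) (t : ℝ) : ℕ := (H.filter fun k => w k ≤ -t).card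

theorem posCount_congr {H : Finset ι} {w w' : ι → ℝ} (h : ∀ k ∈ H, w k = w' k) (t : ℝ) :
    posCount H w t = posCount H w' t := by
  unfold posCount
  congr 1
  exact Finset.filter_congr fun k hk => by rw [h k hk]

theorem negCount_congr {H : Finset ι} {w w' : ι → ℝ} (h : ∀ k ∈ H, w k = w' k) (t : ℝ) :
    negCount H w t = negCount H w' t := by
  unfold negCount
  congr 1
  exact Finset.filter_congr fun k hk => by rw [h k hk]

theorem posCount_le_card (H : Finset ι) (w : ι → ℝ) (t : ℝ) : posCount H w t ≤ H.card :=
  Finset.card_filter_le _ _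

theorem posCount_eq_zero {H : Finset ι} {w : ι → ℝ} {t : ℝ} (h : ∀ k ∈ H, |w k| < t) :
    posCount H w t = 0 := by
  unfold posCount
  rw [Finset.card_eq_zero, Finset.filter_eq_empty_iff]
  intro k hk
  have := (abs_lt.mp (h k hk)).2
  linarith

theorem negCount_eq_zero {H : Finset ι} {w : ι → ℝ} {t : ℝ} (h : ∀ k ∈ H, |w k| < t) :
    negCount H w t = 0 := by
  unfold negCount
  rw [Finset.card_eq_zero, Finset.filter_eq_empty_iff]
  intro k hk
  have := (abs_lt.mp (h k hk)).1
  linarith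

/-- The number of heads ever reaches `x` times one plus the number of tails, for the signs of `w` in
the order of decreasing absolute values. -/
def Hits (x : ℝ) (H : Finset ι) (α β : ℕ) (w : ι → ℝ) : Prop :=
  ∃ t : ℝ, 0 < t ∧ x * (β + negCount H w t + 1) ≤ α + posCount H w t

theorem Hits.congr {x : ℝ} {H : Finset ι} {α β : ℕ} {w w' : ι → ℝ} (h : Hits x H α β w)
    (hw : ∀ k ∈ H, w k = w' k) : Hits x H α β w' := by
  obtain ⟨t, ht, h⟩ := h
  rw [posCount_congr hw, negCount_congr hw] at h
  exact ⟨t, ht, h⟩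

variable [DecidableEq ι]

/-- `w` with the signs of the entries in `K` switched. -/
def flip (K : Finset ι) (w : ι → ℝ) : ι → ℝ := fun k => if k ∈ K then -w k else w k

theorem flip_empty (w : ι → ℝ) : flip ∅ w = w := by
  funext k
  simp [flip]

theorem flip_insert {a : ι} {K : Finset ι} (ha : a ∉ K) (w : ι → ℝ) :
    flip (insert a K) w = flip {a} (flip K w) := by
  funext k
  by_cases hk : k = a
  · subst hk
    simp [flip, ha]
  · simp [flip, hk]

theorem abs_flip (K : Finset ι) (w : ι → ℝ) (k : ι) : |flip K w k| = |w k| := by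
  unfold flip
  split_ifs <;> simp

theorem posCount_insert {a : ι} {s : Finset ι} (ha : a ∉ s) (w : ι → ℝ) (t : ℝ) :
    posCount (insert a s) w t = posCount s w t + if t ≤ w a then 1 else 0 := by
  unfold posCount
  rw [Finset.filter_insert]
  split_ifs with h
  · rw [Finset.card_insert_of_notMem (by simp [ha])]
  · simp

theorem negCount_insert {a : ι} {s : Finset ι} (ha : a ∉ s) (w : ι → ℝ) (t : ℝ) :
    negCount (insert a s) w t = negCount s w t + if w a ≤ -t then 1 else 0 := by
  unfold negCount
  rw [Finset.filter_insert]
  split_ifs with h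
  · rw [Finset.card_insert_of_notMem (by simp [ha])]
  · simp

/-- The counts of the set with an additional largest entry. -/
theorem counts_insert {a : ι} {s : Finset ι} (ha : a ∉ s) {w : ι → ℝ}
    (hmax : ∀ k ∈ s, |w k| ≤ |w a|) {t : ℝ} (ht : 0 < t) :
    (posCount (insert a s) w t = 0 ∧ negCount (insert a s) w t = 0) ∨
    (0 < w a ∧ posCount (insert a s) w t = posCount s w t + 1 ∧
      negCount (insert a s) w t = negCount s w t) ∨
    (w a < 0 ∧ posCount (insert a s) w t = posCount s w t ∧
      negCount (insert a s) w t = negCount s w t + 1) := by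
  rcases lt_or_ge |w a| t with h | h
  · left
    have : ∀ k ∈ insert a s, |w k| < t := fun k hk => by
      rcases Finset.mem_insert.mp hk with rfl | hk
      exacts [h, (hmax k hk).trans_lt h]
    exact ⟨posCount_eq_zero this, negCount_eq_zero this⟩
  · right
    rw [posCount_insert ha, negCount_insert ha]
    rcases le_or_gt 0 (w a) with h0 | h0
    · left
      rw [abs_of_nonneg h0] at h
      rw [if_pos h, if_neg (by linarith)]
      exact ⟨by linarith, rfl, by simp⟩
    · right
      rw [abs_of_neg h0] at h
      rw [if_neg (by linarith), if_pos (by linarith)]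
      exact ⟨h0, by simp, rfl⟩

theorem flip_insert_apply_of_notMem {a : ι} {s K : Finset ι} (ha : a ∉ s) (hK : K ⊆ s)
    (w : ι → ℝ) : flip K w a = w a ∧ flip (insert a K) w a = -w a ∧
      ∀ k ∈ s, flip (insert a K) w k = flip K w k := by
  have haK : a ∉ K := fun h => ha (hK h)
  refine ⟨by simp [flip, haK], by simp [flip], fun k hk => ?_⟩
  have : k ≠ a := fun h => ha (h ▸ hk)
  simp [flip, this]

/-- The entry of largest absolute value is the first toss: every threshold that counts anything
counts it. If the level is not reached yet, it must be reached after this toss. -/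
theorem Hits.of_insert {x : ℝ} {a : ι} {s : Finset ι} (ha : a ∉ s) {w : ι → ℝ}
    (hmax : ∀ k ∈ s, |w k| ≤ |w a|) {α β : ℕ} (hαβ : ¬ x * (β + 1) ≤ α)
    (h : Hits x (insert a s) α β w) :
    (0 < w a ∧ Hits x s (α + 1) β w) ∨ (w a < 0 ∧ Hits x s α (β + 1) w) := by
  obtain ⟨t, ht, h⟩ := h
  rcases counts_insert ha hmax ht with ⟨h1, h2⟩ | ⟨h0, h1, h2⟩ | ⟨h0, h1, h2⟩ <;> rw [h1, h2] at h
  · exact (hαβ (by simpa using h)).elim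
  · refine Or.inl ⟨h0, t, ht, ?_⟩
    push_cast at h ⊢
    linarith
  · refine Or.inr ⟨h0, t, ht, ?_⟩
    push_cast at h ⊢
    linarith

-- Reveal signs in the order of decreasing absolute value. The patterns `K` and `insert a K` differ
-- only in the first toss, one giving a head and the other a tail, which reproduces the recursion of
-- `hitProb`. Ties and zeros only lose hits, hence an inequality.
open Classical in
theorem sum_hits_le (x : ℝ) (H : Finset ι) (w : ι → ℝ) (α β : ℕ) :
    ∑ K ∈ H.powerset, (if Hits x H α β (flip K w) then (1 : ℝ) else 0)
      ≤ 2 ^ H.card * hitProb x H.card α β := by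
  have trivial_bound : ∀ (H : Finset ι) (P : Finset ι → Prop),
      ∑ K ∈ H.powerset, (if P K then (1 : ℝ) else 0) ≤ 2 ^ H.card := fun H P => by
    calc ∑ K ∈ H.powerset, (if P K then (1 : ℝ) else 0) ≤ ∑ K ∈ H.powerset, (1 : ℝ) :=
          Finset.sum_le_sum fun K _ => by split_ifs <;> norm_num
      _ = 2 ^ H.card := by simp
  induction H using Finset.induction_on_max_value (fun k => |w k|) generalizing α β with
  | empty =>
    by_cases h : x * (β + 1) ≤ α
    · rw [hitProb_of_le h, mul_one]
      exact trivial_bound _ _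
    · have : ¬ Hits x ∅ α β (flip ∅ w) := by
        rintro ⟨t, -, h'⟩
        exact h (by simpa [posCount, negCount] using h')
      rw [Finset.powerset_empty, Finset.sum_singleton, if_neg this]
      exact mul_nonneg (by positivity) (hitProb_nonneg _ _ _ _)
  | insert a s ha hmax ih =>
    by_cases h : x * (β + 1) ≤ α
    · rw [hitProb_of_le h, mul_one]
      exact trivial_bound _ _
    have hstep : ∀ K ∈ s.powerset,
        (if Hits x (insert a s) α β (flip K w) then (1 : ℝ) else 0) +
          (if Hits x (insert a s) α β (flip (insert a K) w) then (1 : ℝ) else 0)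
        ≤ (if Hits x s (α + 1) β (flip K w) then (1 : ℝ) else 0) +
          (if Hits x s α (β + 1) (flip K w) then (1 : ℝ) else 0) := by
      intro K hK
      obtain ⟨e1, e2, e3⟩ := flip_insert_apply_of_notMem ha (Finset.mem_powerset.mp hK) w
      have k1 := fun h' => Hits.of_insert ha (w := flip K w) (α := α) (β := β) (x := x)
        (by simpa [abs_flip] using hmax) h h'
      have k2 := fun h' => Hits.of_insert ha (w := flip (insert a K) w) (α := α) (β := β) (x := x)
        (by simpa [abs_flip] using hmax) h h'
      rw [e1] at k1
      rw [e2] at k2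
      have k2' : Hits x (insert a s) α β (flip (insert a K) w) →
          (w a < 0 ∧ Hits x s (α + 1) β (flip K w)) ∨
          (0 < w a ∧ Hits x s α (β + 1) (flip K w)) := fun h' => by
        rcases k2 h' with ⟨h0, h1⟩ | ⟨h0, h1⟩
        · exact Or.inl ⟨by linarith, h1.congr e3⟩
        · exact Or.inr ⟨by linarith, h1.congr e3⟩
      by_cases p1 : Hits x s (α + 1) β (flip K w) <;> by_cases p2 : Hits x s α (β + 1) (flip K w)
      · simp only [p1, p2, if_true]
        split_ifs <;> norm_num
      · simp only [p1, p2, if_true, if_false]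
        simp only [p1, p2, and_true, and_false, or_false] at k1 k2'
        split_ifs with q1 q2
        · linarith [k1 q1, k2' q2]
        all_goals norm_num
      · simp only [p1, p2, if_true, if_false]
        simp only [p1, p2, and_true, and_false, false_or] at k1 k2'
        split_ifs with q1 q2
        · linarith [k1 q1, k2' q2]
        all_goals norm_num
      · simp only [p1, p2, and_false, or_false] at k1 k2'
        rw [if_neg k1, if_neg k2', if_neg p1, if_neg p2]
    rw [Finset.sum_powerset_insert ha, ← Finset.sum_add_distrib]
    refine (Finset.sum_le_sum hstep).trans ?_
    rw [Finset.sum_add_distrib, Finset.card_insert_of_notMem ha, hitProb, if_neg h]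
    have h1 := ih (α + 1) β
    have h2 := ih α (β + 1)
    rw [pow_succ]
    linarith

/-- For any choice of thresholds, the ratio of the positive count to one plus the negative count has
mean at most `1.93` under random signs. -/
theorem sum_ratio_one_le (H : Finset ι) (w : ι → ℝ) (t : Finset ι → ℝ) (ht : ∀ K, 0 < t K) :
    ∑ K ∈ H.powerset, (posCount H (flip K w) (t K) : ℝ) / (1 + negCount H (flip K w) (t K))
      ≤ 2 ^ H.card * 1.93 := by
  classical
  set M : Finset ι → ℝ := fun K =>
    (posCount H (flip K w) (t K) : ℝ) / (1 + negCount H (flip K w) (t K)) with hM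
  have hM0 : ∀ K, 0 ≤ M K := fun K => by positivity
  have hMle : ∀ K, M K ≤ ((14 + H.card : ℕ) : ℝ) := fun K => by
    calc M K ≤ posCount H (flip K w) (t K) :=
          div_le_self (Nat.cast_nonneg _) (le_add_of_nonneg_right (Nat.cast_nonneg _))
      _ ≤ _ := by
        have := posCount_le_card H (flip K w) (t K)
        exact_mod_cast this.trans (by omega)
  have h2 : (0 : ℝ) < 2 ^ H.card := by positivity
  -- `E b` is the average of `min (M K) b` over all sign patterns. The choice `m = H.card` makes the
  -- final truncation level exceed every `M K`.
  have key := le_of_hitProb_bound (n := H.card)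
    (E := fun b => (∑ K ∈ H.powerset, min (M K) b) / 2 ^ H.card)
    (by
      apply div_nonpos_of_nonpos_of_nonneg _ h2.le
      exact Finset.sum_nonpos fun K _ => min_le_right _ _)
    (by
      intro a b ha hab
      have hs := sum_hits_le a H w 0 0
      have : ∀ K, min (M K) b ≤ min (M K) a +
          (b - a) * (if Hits a H 0 0 (flip K w) then (1 : ℝ) else 0) := by
        intro K
        by_cases hK : Hits a H 0 0 (flip K w)
        · rw [if_pos hK, mul_one]
          rcases le_total (M K) a with h | h
          · rw [min_eq_left h]
            linarith [min_le_left (M K) b]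
          · rw [min_eq_right h]
            linarith [min_le_right (M K) b]
        · rw [if_neg hK, mul_zero, add_zero]
          have : M K < a := by
            by_contra! hc
            refine hK ⟨t K, ht K, ?_⟩
            rw [hM, le_div_iff₀ (by positivity)] at hc
            push_cast
            linarith
          rw [min_eq_left this.le]
          exact min_le_left _ _
      have hsum := Finset.sum_le_sum (s := H.powerset) fun K _ => this K
      rw [Finset.sum_add_distrib, ← Finset.mul_sum] at hsum
      rw [div_le_iff₀ h2, add_mul, div_mul_cancel₀ _ h2.ne']
      have := mul_le_mul_of_nonneg_left hs (sub_nonneg.mpr hab)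
      linarith) H.card
  rw [div_le_iff₀ h2] at key
  rw [mul_comm]
  refine le_trans (Finset.sum_le_sum fun K _ => ?_) key
  exact (min_eq_left (hMle K)).ge

/-- Here `α` counts the heads before the first tail. Each of them costs at most `1 / 0.01 = 100`,
and from the first tail on the denominator is at least `1` plus the later tails, which costs `1.93`
more. The expected number of further heads before the first tail is at most one, whence `100 +
1.93`. Indeed `f(α) = 100 α + 101.93` solves `2 f(α) = f(α + 1) + 100 α + 1.93`. -/
theorem sum_ratio_hundredth_le_of_heads (H : Finset ι) (w : ι → ℝ) (t : Finset ι → ℝ)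
    (ht : ∀ K, 0 < t K) (α : ℕ) :
    ∑ K ∈ H.powerset, ((α : ℝ) + posCount H (flip K w) (t K)) /
      (0.01 + negCount H (flip K w) (t K)) ≤ 2 ^ H.card * (100 * α + 101.93) := by
  induction H using Finset.induction_on_max_value (fun k => |w k|) generalizing α t with
  | empty =>
    simp only [Finset.powerset_empty, Finset.sum_singleton, posCount, negCount,
      Finset.filter_empty, Finset.card_empty]
    norm_num
    linarith
  | insert a s ha hmax ih =>
    rw [Finset.sum_powerset_insert ha, Finset.card_insert_of_notMem ha]
    have e := fun K (hK : K ∈ s.powerset) =>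
      flip_insert_apply_of_notMem ha (Finset.mem_powerset.mp hK) w
    have heads : ∀ (v : ι → ℝ) (τ : ℝ), 0 < τ → (∀ k ∈ s, |v k| ≤ |v a|) → 0 ≤ v a →
        ((α : ℝ) + posCount (insert a s) v τ) / (0.01 + negCount (insert a s) v τ)
          ≤ (((α + 1 : ℕ) : ℝ) + posCount s v τ) / (0.01 + negCount s v τ) := by
      intro v τ hτ hv h0
      have hn : negCount s v τ ≤ negCount (insert a s) v τ := by
        rw [negCount_insert ha]
        omega
      have hp : posCount (insert a s) v τ ≤ posCount s v τ + 1 := by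
        rw [posCount_insert ha]
        split_ifs <;> omega
      have hn' : (negCount s v τ : ℝ) ≤ negCount (insert a s) v τ := by exact_mod_cast hn
      have hp' : (posCount (insert a s) v τ : ℝ) ≤ posCount s v τ + 1 := by exact_mod_cast hp
      push_cast
      gcongr ?_ / (0.01 + ?_)
      linarith
    -- A threshold above `|v a|` leaves `α / 0.01`. Any other one includes the tail at `a`, and the
    -- denominator becomes `1.01 + negCount s v τ`.
    have tails : ∀ (v : ι → ℝ) (τ : ℝ), 0 < τ → (∀ k ∈ s, |v k| ≤ |v a|) → v a ≤ 0 →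
        ((α : ℝ) + posCount (insert a s) v τ) / (0.01 + negCount (insert a s) v τ)
          ≤ 100 * α + (posCount s v τ : ℝ) / (1 + negCount s v τ) := by
      intro v τ hτ hv h0
      have hr : 0 ≤ (posCount s v τ : ℝ) / (1 + negCount s v τ) := by positivity
      rcases counts_insert ha hv hτ with ⟨h1, h2⟩ | ⟨h, -, -⟩ | ⟨-, h1, h2⟩
      · rw [h1, h2]
        norm_num at hr ⊢
        linarith
      · linarith
      · rw [h1, h2, add_div]
        push_cast
        apply add_le_add
        · rw [div_le_iff₀ (by positivity)]
          have : (0 : ℝ) ≤ α * negCount s v τ := by positivity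
          nlinarith [Nat.cast_nonneg (α := ℝ) α]
        · gcongr ?_ / ?_
          · exact le_rfl
          · linarith
    have absK : ∀ K, ∀ k ∈ s, |flip K w k| ≤ |flip K w a| := fun K => by
      simpa [abs_flip] using hmax
    -- The sign of `w a` decides which of `K` and `insert a K` has the head; the threshold functions
    -- are exchanged accordingly.
    have hpair : ∃ t₁ t₂ : Finset ι → ℝ, (∀ K, 0 < t₁ K) ∧ (∀ K, 0 < t₂ K) ∧
        ∀ K ∈ s.powerset,
          ((α : ℝ) + posCount (insert a s) (flip K w) (t K)) /
              (0.01 + negCount (insert a s) (flip K w) (t K)) +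
            ((α : ℝ) + posCount (insert a s) (flip (insert a K) w) (t (insert a K))) /
              (0.01 + negCount (insert a s) (flip (insert a K) w) (t (insert a K)))
          ≤ (((α + 1 : ℕ) : ℝ) + posCount s (flip K w) (t₁ K)) /
              (0.01 + negCount s (flip K w) (t₁ K)) + (100 * α +
            (posCount s (flip K w) (t₂ K) : ℝ) / (1 + negCount s (flip K w) (t₂ K))) := by
      rcases le_total 0 (w a) with h0 | h0
      · refine ⟨t, fun K => t (insert a K), ht, fun K => ht _, fun K hK => ?_⟩
        obtain ⟨e1, e2, e3⟩ := e K hK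
        have h1 := heads (flip K w) (t K) (ht K) (absK K) (by rwa [e1])
        have h2 := tails (flip (insert a K) w) (t (insert a K)) (ht _) (absK _)
          (by rw [e2]; linarith)
        rw [posCount_congr e3, negCount_congr e3] at h2
        exact add_le_add h1 h2
      · refine ⟨fun K => t (insert a K), t, fun K => ht _, ht, fun K hK => ?_⟩
        obtain ⟨e1, e2, e3⟩ := e K hK
        have h1 := tails (flip K w) (t K) (ht K) (absK K) (by rwa [e1])
        have h2 := heads (flip (insert a K) w) (t (insert a K)) (ht _) (absK _)
          (by rw [e2]; linarith)
        rw [posCount_congr e3, negCount_congr e3] at h2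
        rw [add_comm]
        exact add_le_add h2 h1
    obtain ⟨t₁, t₂, ht₁, ht₂, hle⟩ := hpair
    rw [← Finset.sum_add_distrib]
    refine (Finset.sum_le_sum hle).trans ?_
    rw [Finset.sum_add_distrib, Finset.sum_add_distrib]
    have h1 := ih t₁ ht₁ (α + 1)
    have h2 := sum_ratio_one_le s w t₂ ht₂
    have h3 : ∑ K ∈ s.powerset, (100 * (α : ℝ)) = 2 ^ s.card * (100 * α) := by simp
    rw [h3, pow_succ]
    push_cast at h1 ⊢
    linarith

/-- For both admissible pairs `(a, c)` and any choice of thresholds, the ratio of the positive count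
to `a` plus the negative count has mean at most `c` under random signs. -/
theorem sum_ratio_le {a c : ℝ} (hac : (a = 1 ∧ c = 1.93) ∨ (a = 0.01 ∧ c = 102))
    (H : Finset ι) (w : ι → ℝ) (t : Finset ι → ℝ) (ht : ∀ K, 0 < t K) :
    ∑ K ∈ H.powerset, (posCount H (flip K w) (t K) : ℝ) / (a + negCount H (flip K w) (t K))
      ≤ 2 ^ H.card * c := by
  rcases hac with ⟨rfl, rfl⟩ | ⟨rfl, rfl⟩
  · exact sum_ratio_one_le H w t ht
  · have h := sum_ratio_hundredth_le_of_heads H w t ht 0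
    have h2 : (0 : ℝ) < 2 ^ H.card := by positivity
    simp only [Nat.cast_zero, zero_add, mul_zero] at h
    refine h.trans ?_
    gcongr
    norm_num

end SignFlips

/-! ### From sign invariance in law to a bound on the mean -/

section SignInvariance

variable {ι : Type*}

/-- The largest ratio of the positive count to `a` plus the negative count over all thresholds. -/
def signRatio (a : ℝ) (H : Finset ι) (w : ι → ℝ) : ℝ≥0∞ :=
  ⨆ j, if w j = 0 then 0 else
    ENNReal.ofReal (posCount H w |w j| / (a + negCount H w |w j|))

theorem le_signRatio (a : ℝ) (H : Finset ι) (w : ι → ℝ) {j : ι} (hj : w j ≠ 0) :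
    ENNReal.ofReal (posCount H w |w j| / (a + negCount H w |w j|)) ≤ signRatio a H w := by
  have := le_iSup (fun j => if w j = 0 then 0 else
    ENNReal.ofReal (posCount H w |w j| / (a + negCount H w |w j|))) j
  simp only [hj, if_false] at this
  exact this

/-- A finite supremum is attained. If it is attained at a zero entry its value is `0`, and any
threshold will do. -/
theorem exists_signRatio_le [Finite ι] {a : ℝ} (H : Finset ι) (w : ι → ℝ) :
    ∃ t : ℝ, 0 < t ∧
      signRatio a H w ≤ ENNReal.ofReal (posCount H w t / (a + negCount H w t)) := by
  rcases isEmpty_or_nonempty ι with hι | hι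
  · exact ⟨1, one_pos, by simp [signRatio]⟩
  obtain ⟨j, hj⟩ := exists_eq_ciSup_of_finite (f := fun j => if w j = 0 then 0 else
    ENNReal.ofReal (posCount H w |w j| / (a + negCount H w |w j|)))
  by_cases hw : w j = 0
  · refine ⟨1, one_pos, ?_⟩
    rw [signRatio, ← hj, if_pos hw]
    simp
  · refine ⟨|w j|, abs_pos.mpr hw, ?_⟩
    rw [signRatio, ← hj, if_neg hw]

theorem measurable_card_filter {S : Type*} [MeasurableSpace S] (H : Finset ι)
    (Q : ι → S → Prop) [∀ w, DecidablePred fun k => Q k w] (hQ : ∀ k, MeasurableSet {w | Q k w}) :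
    Measurable fun w => ((H.filter fun k => Q k w).card : ℝ) := by
  classical
  have h := Finset.measurable_fun_sum H fun k _ =>
    (measurable_const (a := (1 : ℝ))).indicator (hQ k)
  convert h using 2 with w
  simp [Set.indicator_apply, Finset.sum_boole]

theorem measurable_signRatio [Countable ι] (a : ℝ) (H : Finset ι) :
    Measurable (signRatio a H) := by
  refine Measurable.iSup fun j => ?_
  refine Measurable.ite (measurableSet_eq_fun (measurable_pi_apply j) measurable_const)
    measurable_const (ENNReal.measurable_ofReal.comp ?_)
  refine Measurable.div ?_ (measurable_const.add ?_)
  · exact measurable_card_filter H (fun k (w : ι → ℝ) => |w j| ≤ w k) fun k =>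
      measurableSet_le (by fun_prop) (by fun_prop)
  · exact measurable_card_filter H (fun k (w : ι → ℝ) => w k ≤ -|w j|) fun k =>
      measurableSet_le (by fun_prop) (by fun_prop)

theorem measurable_flip [DecidableEq ι] (K : Finset ι) :
    Measurable (flip K : (ι → ℝ) → ι → ℝ) := by
  refine measurable_pi_lambda _ fun k => ?_
  unfold flip
  split_ifs <;> fun_prop

theorem map_flip [DecidableEq ι] {S : Type*} [MeasurableSpace S] {ν : Measure S} {W : S → ι → ℝ}
    (hW : Measurable W) (H : Finset ι)
    (hflip : ∀ j ∈ H, ν.map (fun s => flip {j} (W s)) = ν.map W) (K : Finset ι) (hK : K ⊆ H) :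
    ν.map (fun s => flip K (W s)) = ν.map W := by
  induction K using Finset.induction_on with
  | empty => simp only [flip_empty]
  | insert a K ha ih =>
    simp only [flip_insert ha]
    have h1 := ih fun k hk => hK (Finset.mem_insert_of_mem hk)
    have h2 := hflip a (hK (Finset.mem_insert_self _ _))
    have h3 := Measure.map_map (μ := ν) (measurable_flip {a}) ((measurable_flip K).comp hW)
    have h4 := Measure.map_map (μ := ν) (measurable_flip {a}) hW
    simp only [Function.comp_def] at h3 h4
    rw [← h3, h1, h4, h2]

variable [Finite ι] [DecidableEq ι]

theorem sum_signRatio_le {a c : ℝ} (hac : (a = 1 ∧ c = 1.93) ∨ (a = 0.01 ∧ c = 102))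
    (H : Finset ι) (w : ι → ℝ) :
    ∑ K ∈ H.powerset, signRatio a H (flip K w) ≤ 2 ^ H.card * ENNReal.ofReal c := by
  have ha : 0 ≤ a := by rcases hac with ⟨rfl, -⟩ | ⟨rfl, -⟩ <;> norm_num
  choose t ht hle using fun K : Finset ι => exists_signRatio_le (a := a) H (flip K w)
  refine (Finset.sum_le_sum fun K _ => hle K).trans ?_
  rw [← ENNReal.ofReal_sum_of_nonneg fun K _ => by positivity]
  refine (ENNReal.ofReal_le_ofReal (sum_ratio_le hac H w t ht)).trans ?_
  rw [ENNReal.ofReal_mul (by positivity), ENNReal.ofReal_pow (by norm_num)]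
  simp

/-- Sign flip invariance bounds the mean of the largest ratio. -/
theorem lintegral_signRatio_le {S : Type*} [MeasurableSpace S] {ν : Measure S}
    [IsProbabilityMeasure ν] {W : S → ι → ℝ} (hW : Measurable W) {a c : ℝ}
    (hac : (a = 1 ∧ c = 1.93) ∨ (a = 0.01 ∧ c = 102)) (H : Finset ι)
    (hflip : ∀ j ∈ H, ν.map (fun s => flip {j} (W s)) = ν.map W) :
    ∫⁻ s, signRatio a H (W s) ∂ν ≤ ENNReal.ofReal c := by
  have hK : ∀ K ∈ H.powerset,
      ∫⁻ s, signRatio a H (flip K (W s)) ∂ν = ∫⁻ s, signRatio a H (W s) ∂ν := by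
    intro K hK
    have h1 := lintegral_map (μ := ν) (measurable_signRatio a H) ((measurable_flip K).comp hW)
    have h2 := lintegral_map (μ := ν) (measurable_signRatio a H) hW
    simp only [Function.comp_def] at h1
    rw [← h1, ← h2, map_flip hW H hflip K (Finset.mem_powerset.mp hK)]
  -- All `2 ^ H.card` sign patterns give the same integral, so their sum may be bounded pointwise.
  have hsum : (2 : ℝ≥0∞) ^ H.card * ∫⁻ s, signRatio a H (W s) ∂ν
      ≤ 2 ^ H.card * ENNReal.ofReal c := by
    calc (2 : ℝ≥0∞) ^ H.card * ∫⁻ s, signRatio a H (W s) ∂ν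
        = ∑ K ∈ H.powerset, ∫⁻ s, signRatio a H (flip K (W s)) ∂ν := by
          rw [Finset.sum_congr rfl hK]
          simp
      _ = ∫⁻ s, ∑ K ∈ H.powerset, signRatio a H (flip K (W s)) ∂ν := by
          rw [lintegral_finsetSum]
          exact fun K _ => (measurable_signRatio a H).comp ((measurable_flip K).comp hW)
      _ ≤ ∫⁻ s, 2 ^ H.card * ENNReal.ofReal c ∂ν :=
          lintegral_mono fun s => sum_signRatio_le hac H (W s)
      _ = 2 ^ H.card * ENNReal.ofReal c := by simp
  exact (ENNReal.mul_le_mul_iff_right (by simp) (by finiteness)).mp hsum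

end SignInvariance

/-! ### Knockoff pairs and the swapping reflection -/

section KnockoffAlgebra

open scoped RealInnerProductSpace

theorem replaceCols_apply {n : ℕ} {ι : Type} [DecidableEq ι] (K : Finset ι)
    (X Y : Matrix (Fin n) ι ℝ) (k : Fin n) (l : ι) :
    replaceCols K X Y k l = if l ∈ K then Y k l else X k l := rfl

variable {n : ℕ} {ι : Type} [Fintype ι] [DecidableEq ι]

theorem IsStrategyVector.nonneg {O : Strategy} {X : Matrix (Fin n) ι ℝ} {s : ι → ℝ}
    (h : IsStrategyVector O X s) (j : ι) : 0 ≤ s j := by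
  cases O with
  | equi =>
    have hpsd : (Xᵀ * X).PosSemidef := by
      have := posSemidef_conjTranspose_mul_self X
      rwa [conjTranspose_eq_transpose_of_trivial] at this
    have h0 : 0 ≤ sInf (spectrum ℝ (Xᵀ * X)) := by
      refine Real.sInf_nonneg fun x hx => ?_
      rw [hpsd.isHermitian.spectrum_real_eq_range_eigenvalues] at hx
      obtain ⟨i, rfl⟩ := hx
      exact hpsd.eigenvalues_nonneg i
    rw [h j]
    exact le_min (by linarith) zero_le_one
  | sdp => exact (h.1.2 j).1

/-- The construction yields a knockoff pair. -/
theorem IsConstructedKnockoff.isKnockoffPair {O : Strategy} {X Xt : Matrix (Fin n) ι ℝ}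
    (hX : IsUnit (Xᵀ * X)) (h : IsConstructedKnockoff O X Xt) : IsKnockoffPair X Xt := by
  obtain ⟨s, U, C, hs, hU, hXU, hC, rfl⟩ := h
  have hdet : IsUnit (Xᵀ * X).det := (isUnit_iff_isUnit_det _).mp hX
  have hUX : Uᵀ * X = 0 := by
    have := congrArg transpose hXU
    simpa [transpose_mul] using this
  set G := Xᵀ * X with hG
  have hGG : G * G⁻¹ = 1 := mul_nonsing_inv _ hdet
  have hGG' : G⁻¹ * G = 1 := nonsing_inv_mul _ hdet
  have hGt : G⁻¹ᵀ = G⁻¹ := by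
    rw [transpose_nonsing_inv, hG, transpose_mul, transpose_transpose]
  refine ⟨hX, s, fun j => hs.nonneg j, ?_, ?_⟩
  · rw [Matrix.mul_add, ← Matrix.mul_assoc, ← Matrix.mul_assoc, hXU, Matrix.zero_mul, add_zero,
      Matrix.mul_sub, Matrix.mul_one, ← Matrix.mul_assoc, ← hG, hGG, Matrix.one_mul]
  · rw [transpose_add, transpose_mul, transpose_mul, Matrix.add_mul, Matrix.mul_add, Matrix.mul_add]
    have e1 : (1 - G⁻¹ * diagonal s)ᵀ * Xᵀ * (U * C) = 0 := by
      rw [Matrix.mul_assoc, ← Matrix.mul_assoc Xᵀ, hXU, Matrix.zero_mul, Matrix.mul_zero]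
    have e2 : Cᵀ * Uᵀ * (X * (1 - G⁻¹ * diagonal s)) = 0 := by
      rw [Matrix.mul_assoc, ← Matrix.mul_assoc Uᵀ, hUX, Matrix.zero_mul, Matrix.mul_zero]
    have e3 : Cᵀ * Uᵀ * (U * C) = Cᵀ * C := by
      rw [Matrix.mul_assoc, ← Matrix.mul_assoc Uᵀ, hU, Matrix.one_mul]
    have e4 : (1 - G⁻¹ * diagonal s)ᵀ * Xᵀ * (X * (1 - G⁻¹ * diagonal s))
        = G - 2 • diagonal s + diagonal s * G⁻¹ * diagonal s := by
      rw [Matrix.mul_assoc, ← Matrix.mul_assoc Xᵀ, ← hG, transpose_sub, transpose_one,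
        transpose_mul, diagonal_transpose, hGt, Matrix.mul_sub, Matrix.mul_one,
        ← Matrix.mul_assoc G, hGG, Matrix.one_mul, Matrix.sub_mul, Matrix.one_mul, Matrix.mul_sub,
        Matrix.mul_assoc (diagonal s) G⁻¹ G, hGG', Matrix.mul_one, two_smul]
      abel
    rw [e1, e2, e3, e4, hC]
    abel

/-- Swapping columns with their knockoffs does not change the Gram matrices. -/
theorem IsKnockoffPair.gram_replaceCols {X Xt : Matrix (Fin n) ι ℝ} (h : IsKnockoffPair X Xt)
    (K : Finset ι) :
    (replaceCols K X Xt)ᵀ * replaceCols K X Xt = Xᵀ * X ∧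
    (replaceCols K X Xt)ᵀ * replaceCols K Xt X = Xᵀ * Xt ∧
    (replaceCols K Xt X)ᵀ * replaceCols K X Xt = Xtᵀ * X ∧
    (replaceCols K Xt X)ᵀ * replaceCols K Xt X = Xtᵀ * Xt := by
  obtain ⟨-, s, -, h1, h2⟩ := h
  have h3 : Xtᵀ * X = Xᵀ * X - diagonal s := by
    have := congrArg transpose h1
    simpa [transpose_mul] using this
  have e : ∀ (A B : Matrix (Fin n) ι ℝ) (a b : ι), (Aᵀ * B) a b = ∑ k, A k a * B k b :=
    fun A B a b => by simp [mul_apply]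
  have k1 : ∀ a b, ∑ k, X k a * Xt k b = ∑ k, X k a * X k b - diagonal s a b := fun a b => by
    rw [← e, ← e, h1]; rfl
  have k2 : ∀ a b, ∑ k, Xt k a * Xt k b = ∑ k, X k a * X k b := fun a b => by
    rw [← e, ← e, h2]
  have k3 : ∀ a b, ∑ k, Xt k a * X k b = ∑ k, X k a * X k b - diagonal s a b := fun a b => by
    rw [← e, ← e, h3]; rfl
  -- The Gram blocks differ only by `diagonal s`. Entries whose type changes under the swap have
  -- exactly one index in `K`, so they are off the diagonal.
  have hd : ∀ {a b : ι}, a ∈ K → b ∉ K → diagonal s a b = 0 := fun ha hb =>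
    diagonal_apply_ne _ fun hab => hb (hab ▸ ha)
  have hd' : ∀ {a b : ι}, a ∉ K → b ∈ K → diagonal s a b = 0 := fun ha hb =>
    diagonal_apply_ne _ fun hab => ha (hab ▸ hb)
  refine ⟨?_, ?_, ?_, ?_⟩ <;> ext a b <;> rw [e, e] <;> simp only [replaceCols_apply] <;>
    by_cases ha : a ∈ K <;> by_cases hb : b ∈ K <;>
    simp only [ha, hb, if_true, if_false, k1, k2, k3, hd, hd', not_false_iff, sub_zero]

theorem IsKnockoffPair.replaceCols {X Xt : Matrix (Fin n) ι ℝ} (h : IsKnockoffPair X Xt)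
    (K : Finset ι) : IsKnockoffPair (replaceCols K X Xt) (replaceCols K Xt X) := by
  obtain ⟨g1, g2, -, g4⟩ := h.gram_replaceCols K
  obtain ⟨h0, s, hs, h1, h2⟩ := h
  refine ⟨by rwa [g1], s, hs, by rw [g1, g2, h1], by rw [g1, g4, h2]⟩

theorem IsKnockoffPair.gram_fromCols_replaceCols {X Xt : Matrix (Fin n) ι ℝ}
    (h : IsKnockoffPair X Xt) (K : Finset ι) :
    (fromCols X Xt)ᵀ * fromCols X Xt =
      (fromCols (GGMKnockoff.replaceCols K X Xt) (GGMKnockoff.replaceCols K Xt X))ᵀ *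
        fromCols (GGMKnockoff.replaceCols K X Xt) (GGMKnockoff.replaceCols K Xt X) := by
  obtain ⟨g1, g2, g3, g4⟩ := h.gram_replaceCols K
  rw [transpose_fromCols, transpose_fromCols, fromRows_mul_fromCols, fromRows_mul_fromCols,
    g1, g2, g3, g4]

/-- A linear isometry acting on coordinate vectors. -/
def isometryAct (Q : EuclideanSpace ℝ (Fin n) ≃ₗᵢ[ℝ] EuclideanSpace ℝ (Fin n)) (y : Fin n → ℝ) :
    Fin n → ℝ :=
  (Q (WithLp.toLp 2 y)).ofLp

theorem isometryAct_add (Q : EuclideanSpace ℝ (Fin n) ≃ₗᵢ[ℝ] EuclideanSpace ℝ (Fin n))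
    (y y' : Fin n → ℝ) : isometryAct Q (y + y') = isometryAct Q y + isometryAct Q y' := by
  simp [isometryAct]

theorem isometryAct_smul (Q : EuclideanSpace ℝ (Fin n) ≃ₗᵢ[ℝ] EuclideanSpace ℝ (Fin n))
    (r : ℝ) (y : Fin n → ℝ) : isometryAct Q (r • y) = r • isometryAct Q y := by
  simp [isometryAct]

theorem isometryAct_sum {κ : Type*}
    (Q : EuclideanSpace ℝ (Fin n) ≃ₗᵢ[ℝ] EuclideanSpace ℝ (Fin n))
    (s : Finset κ) (f : κ → Fin n → ℝ) :
    isometryAct Q (∑ i ∈ s, f i) = ∑ i ∈ s, isometryAct Q (f i) := by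
  simp [isometryAct]

/-- The reflection that swaps a column of the design matrix with its knockoff and fixes all other
columns. -/
theorem IsKnockoffPair.exists_swap {X Xt : Matrix (Fin n) ι ℝ} (h : IsKnockoffPair X Xt) (j : ι) :
    ∃ Q : EuclideanSpace ℝ (Fin n) ≃ₗᵢ[ℝ] EuclideanSpace ℝ (Fin n),
      (∀ u y : Fin n → ℝ, u ⬝ᵥ isometryAct Q y = isometryAct Q u ⬝ᵥ y) ∧
      isometryAct Q (X.col j) = Xt.col j ∧ isometryAct Q (Xt.col j) = X.col j ∧
      ∀ l, l ≠ j → isometryAct Q (X.col l) = X.col l ∧ isometryAct Q (Xt.col l) = Xt.col l := by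
  obtain ⟨-, s, -, h1, h2⟩ := h
  have e : ∀ (A B : Matrix (Fin n) ι ℝ) (a b : ι), (Aᵀ * B) a b = A.col a ⬝ᵥ B.col b :=
    fun A B a b => by simp [mul_apply, dotProduct]
  have hin : ∀ u v : Fin n → ℝ, ⟪WithLp.toLp 2 u, WithLp.toLp 2 v⟫ = u ⬝ᵥ v := fun u v => by
    simp [PiLp.inner_apply, dotProduct, mul_comm]
  have k1 : ∀ a b, X.col a ⬝ᵥ Xt.col b = X.col a ⬝ᵥ X.col b - diagonal s a b := fun a b => by
    rw [← e, ← e, h1]; rfl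
  have k2 : ∀ a b, Xt.col a ⬝ᵥ Xt.col b = X.col a ⬝ᵥ X.col b := fun a b => by
    rw [← e, ← e, h2]
  set x : EuclideanSpace ℝ (Fin n) := WithLp.toLp 2 (X.col j) with hx
  set y : EuclideanSpace ℝ (Fin n) := WithLp.toLp 2 (Xt.col j) with hy
  have hnorm : ‖x‖ = ‖y‖ := by
    rw [← sq_eq_sq₀ (norm_nonneg _) (norm_nonneg _), ← real_inner_self_eq_norm_sq,
      ← real_inner_self_eq_norm_sq, hin, hin, k2]
  -- Reflection in the hyperplane orthogonal to `x - y`: it exchanges `x` and `y`, which have equal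
  -- norms. It fixes the other columns, since their inner products with `x` and `y` agree.
  set Q := (ℝ ∙ (x - y))ᗮ.reflection with hQ
  have hQQ : ∀ v, Q (Q v) = v := fun v => Submodule.reflection_reflection _ v
  have hQx : Q x = y := Submodule.reflection_sub hnorm
  have hfix : ∀ v : EuclideanSpace ℝ (Fin n), ⟪x - y, v⟫ = 0 → Q v = v := fun v hv => by
    rw [hQ]
    exact Submodule.reflection_mem_subspace_eq_self
      (Submodule.mem_orthogonal_singleton_iff_inner_right.mpr hv)
  refine ⟨Q, fun u v => ?_, ?_, ?_, fun l hl => ⟨?_, ?_⟩⟩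
  · rw [← hin, ← hin]
    simp only [isometryAct, WithLp.toLp_ofLp]
    rw [← Q.inner_map_map (WithLp.toLp 2 u), hQQ]
  · simp only [isometryAct, ← hx, hQx, hy]
  · simp only [isometryAct, ← hy]
    rw [← hQx, hQQ]
  · simp only [isometryAct]
    rw [hfix _ (by
      rw [inner_sub_left, hx, hy, hin, hin, dotProduct_comm (Xt.col j), k1, diagonal_apply_ne _ hl,
        dotProduct_comm, sub_zero, sub_self])]
  · simp only [isometryAct]
    rw [hfix _ (by
      rw [inner_sub_left, hx, hy, hin, hin, k1, k2, diagonal_apply_ne _ hl.symm, sub_zero,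
        sub_self])]

/-- The effect of the swapping reflection of the response on the feature statistics. -/
theorem FeatureProcedure.apply_isometryAct {P : FeatureProcedure n ι} (hs : P.Sufficient)
    (ha : P.Antisymmetric) {X Xt : Matrix (Fin n) ι ℝ} (h : IsKnockoffPair X Xt) (j : ι)
    {Q : EuclideanSpace ℝ (Fin n) ≃ₗᵢ[ℝ] EuclideanSpace ℝ (Fin n)}
    (hQ : ∀ u y : Fin n → ℝ, u ⬝ᵥ isometryAct Q y = isometryAct Q u ⬝ᵥ y)
    (hx : isometryAct Q (X.col j) = Xt.col j) (hxt : isometryAct Q (Xt.col j) = X.col j)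
    (hfix : ∀ l, l ≠ j →
      isometryAct Q (X.col l) = X.col l ∧ isometryAct Q (Xt.col l) = Xt.col l)
    (y : Fin n → ℝ) : P X Xt (isometryAct Q y) = flip {j} (P X Xt y) := by
  -- As `Q` is self-adjoint, reflecting the response has the same effect on the inner products as
  -- swapping the two columns. Sufficiency sees nothing else, and antisymmetry then changes the
  -- sign.
  have h1 : (fromCols X Xt)ᵀ *ᵥ isometryAct Q y =
      (fromCols (replaceCols {j} X Xt) (replaceCols {j} Xt X))ᵀ *ᵥ y := by
    funext b
    change (fun k => fromCols X Xt k b) ⬝ᵥ isometryAct Q y =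
      (fun k => fromCols (replaceCols {j} X Xt) (replaceCols {j} Xt X) k b) ⬝ᵥ y
    rw [hQ]
    congr 1
    rcases b with b | b <;> by_cases hb : b = j
    · subst hb
      exact hx.trans (by funext k; simp [replaceCols_apply])
    · exact (hfix b hb).1.trans (by funext k; simp [replaceCols_apply, hb])
    · subst hb
      exact hxt.trans (by funext k; simp [replaceCols_apply])
    · exact (hfix b hb).2.trans (by funext k; simp [replaceCols_apply, hb])
  rw [hs X Xt _ _ _ y h (h.replaceCols {j}) (h.gram_fromCols_replaceCols {j}) h1]
  funext l
  rw [ha X Xt y {j} h l]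
  rfl

/-- A zero column would put a basis vector in the kernel of the Gram matrix, so the normalizing
lengths do not vanish. -/
theorem ColumnScaling.exists_apply_eq (σ : ColumnScaling) (X : Matrix (Fin n) ι ℝ)
    (hX : IsUnit (Xᵀ * X)) :
    ∃ r : ι → ℝ, (∀ j, r j ≠ 0) ∧ σ.apply X = X * diagonal r := by
  cases σ with
  | raw => exact ⟨1, by simp, by simp [ColumnScaling.apply]⟩
  | unit =>
    refine ⟨fun j => (Real.sqrt (∑ l, X l j ^ 2))⁻¹, fun j => ?_, ?_⟩
    · intro h0
      rw [inv_eq_zero, Real.sqrt_eq_zero (Finset.sum_nonneg fun _ _ => sq_nonneg _),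
        Finset.sum_eq_zero_iff_of_nonneg fun _ _ => sq_nonneg _] at h0
      have hcol : ∀ k, X k j = 0 := fun k => by simpa using h0 k (Finset.mem_univ k)
      have hker : (Xᵀ * X) *ᵥ Pi.single j 1 = 0 := by
        rw [← mulVec_mulVec]
        have : X *ᵥ Pi.single j 1 = 0 := by
          funext k
          simp [hcol k]
        rw [this, mulVec_zero]
      have := (mulVec_injective_iff_isUnit.mpr hX) (hker.trans (mulVec_zero _).symm)
      simpa using congrFun this j
    · ext k j
      simp [ColumnScaling.apply, mul_diagonal, div_eq_mul_inv]

theorem isUnit_gram_mul_diagonal {X : Matrix (Fin n) ι ℝ} (hX : IsUnit (Xᵀ * X)) {r : ι → ℝ}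
    (hr : ∀ j, r j ≠ 0) : IsUnit ((X * diagonal r)ᵀ * (X * diagonal r)) := by
  have hd : IsUnit (diagonal r) := by
    rw [isUnit_iff_isUnit_det, det_diagonal]
    exact (Finset.prod_ne_zero_iff.mpr fun j _ => hr j).isUnit
  rw [transpose_mul, diagonal_transpose, Matrix.mul_assoc, ← Matrix.mul_assoc Xᵀ]
  exact hd.mul (hX.mul hd)

/-- Some linear isometry of the noise in the regression switches the sign of the statistic of a
variable with regression coefficient zero. -/
theorem exists_isometry_flip {P : FeatureProcedure n ι} (hs : P.Sufficient)
    (ha : P.Antisymmetric) (σ : ColumnScaling) {O : Strategy}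
    {knock : Matrix (Fin n) ι ℝ → Matrix (Fin n) ι ℝ}
    (hknock : ∀ D, IsUnit (Dᵀ * D) → IsConstructedKnockoff O D (knock D))
    {D : Matrix (Fin n) ι ℝ} (hD : IsUnit (Dᵀ * D)) (b : ι → ℝ) {j : ι} (hb : b j = 0) :
    ∃ Q : EuclideanSpace ℝ (Fin n) ≃ₗᵢ[ℝ] EuclideanSpace ℝ (Fin n), ∀ e : Fin n → ℝ,
      P (σ.apply D) (knock (σ.apply D)) (D *ᵥ b + isometryAct Q e) =
        flip {j} (P (σ.apply D) (knock (σ.apply D)) (D *ᵥ b + e)) := by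
  obtain ⟨r, hr, hσ⟩ := σ.exists_apply_eq D hD
  have hD' : IsUnit ((σ.apply D)ᵀ * σ.apply D) := by
    rw [hσ]
    exact isUnit_gram_mul_diagonal hD hr
  have hpair := (hknock _ hD').isKnockoffPair hD'
  obtain ⟨Q, hQ, hx, hxt, hfix⟩ := hpair.exists_swap j
  refine ⟨Q, fun e => ?_⟩
  -- `Q` is built from the scaled design; dividing by the nonzero factor carries the fixed columns
  -- over to `D`.
  have hcol : ∀ l, l ≠ j → isometryAct Q (D.col l) = D.col l := by
    intro l hl
    have h1 : (σ.apply D).col l = r l • D.col l := by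
      funext k
      rw [hσ]
      simp [mul_diagonal, mul_comm]
    have h2 := (hfix l hl).1
    rw [h1, isometryAct_smul] at h2
    exact smul_right_injective _ (hr l) h2
  -- The null hypothesis enters here: column `j`, the only column of `D` that `Q` need not fix, has
  -- coefficient zero.
  have hDb : isometryAct Q (D *ᵥ b) = D *ᵥ b := by
    have h1 : D *ᵥ b = ∑ l, b l • D.col l := by
      funext k
      simp [mulVec, dotProduct, mul_comm]
    rw [h1, isometryAct_sum]
    refine Finset.sum_congr rfl fun l _ => ?_
    rw [isometryAct_smul]
    by_cases hl : l = j
    · subst hl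
      rw [hb, zero_smul, zero_smul]
    · rw [hcol l hl]
  rw [← FeatureProcedure.apply_isometryAct hs ha hpair j hQ hx hxt hfix, isometryAct_add, hDb]

end KnockoffAlgebra

/-! ### Regression of one Gaussian coordinate on the others -/

section GaussianRegression

open scoped RealInnerProductSpace

variable {p : ℕ} {Ω : Matrix (Fin p) (Fin p) ℝ}

/-- The law of the noise in the regression of coordinate `i` on the other coordinates. -/
def noiseLaw (Ω : Matrix (Fin p) (Fin p) ℝ) (i : Fin p) : Measure ℝ :=
  gaussianReal 0 (Ω i i)⁻¹.toNNReal

instance (Ω : Matrix (Fin p) (Fin p) ℝ) (i : Fin p) : IsProbabilityMeasure (noiseLaw Ω i) := by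
  unfold noiseLaw
  infer_instance

/-- Coordinate `i` replaced by its regression on the other coordinates plus noise. -/
def regress (Ω : Matrix (Fin p) (Fin p) ℝ) (i : Fin p) (v : EuclideanSpace ℝ (Fin p) × ℝ) :
    EuclideanSpace ℝ (Fin p) :=
  v.1 + (v.2 - (Ω i i)⁻¹ * ∑ l, Ω i l * v.1 l) • EuclideanSpace.single i 1

theorem measurable_regress (Ω : Matrix (Fin p) (Fin p) ℝ) (i : Fin p) :
    Measurable (regress Ω i) := by
  unfold regress
  fun_prop

theorem regress_apply_of_ne {i l : Fin p} (hl : l ≠ i) (v : EuclideanSpace ℝ (Fin p) × ℝ) :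
    regress Ω i v l = v.1 l := by
  simp [regress, hl]

theorem regress_apply_self {i : Fin p} (hi : Ω i i ≠ 0) (v : EuclideanSpace ℝ (Fin p) × ℝ) :
    regress Ω i v i = ∑ l : Others i, v.1 l * (-(Ω i l / Ω i i)) + v.2 := by
  have h1 : ∑ l, Ω i l * v.1 l = Ω i i * v.1 i + ∑ l : Others i, Ω i l * v.1 l := by
    rw [Fintype.sum_eq_add_sum_subtype_ne _ i]
  have h2 : ∑ l : Others i, v.1 l * (-(Ω i l / Ω i i)) =
      -((Ω i i)⁻¹ * ∑ l : Others i, Ω i l * v.1 l) := by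
    rw [Finset.mul_sum, ← Finset.sum_neg_distrib]
    exact Finset.sum_congr rfl fun l _ => by ring
  have h3 : regress Ω i v i = v.1 i + (v.2 - (Ω i i)⁻¹ * ∑ l, Ω i l * v.1 l) := by
    simp [regress]
  rw [h3, h1, h2, mul_add, inv_mul_cancel_left₀ hi]
  ring

/-- Regression of one coordinate of a centered Gaussian vector on the others. -/
theorem map_regress (hΩ : Ω.PosDef) (i : Fin p) :
    ((multivariateGaussian 0 Ω⁻¹).prod (noiseLaw Ω i)).map (regress Ω i) =
      multivariateGaussian 0 Ω⁻¹ := by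
  have hS : Ω⁻¹.PosSemidef := hΩ.inv.posSemidef
  have hii : 0 < Ω i i := hΩ.diag_pos
  have hdet : IsUnit Ω.det := (isUnit_iff_isUnit_det _).mp hΩ.isUnit
  have hsymm : Ωᵀ = Ω := by
    have := hΩ.isHermitian
    rwa [IsHermitian, conjTranspose_eq_transpose_of_trivial] at this
  apply Measure.ext_of_charFun
  ext t
  -- `u` is the adjoint of the linear map in `v.1` applied to `t`; the characteristic function
  -- therefore splits into one factor at `u` and one at `t i`.
  set u : EuclideanSpace ℝ (Fin p) := WithLp.toLp 2 (t.ofLp - ((Ω i i)⁻¹ * t i) • Ω i) with hu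
  have hinner : ∀ v : EuclideanSpace ℝ (Fin p) × ℝ,
      ⟪regress Ω i v, t⟫ = ⟪v.1, u⟫ + ⟪v.2, t i⟫ := by
    intro v
    have e1 : ⟪v.1, u⟫ = ⟪v.1, t⟫ - ((Ω i i)⁻¹ * t i) * ∑ l, Ω i l * v.1 l := by
      simp only [PiLp.inner_apply, hu, Finset.mul_sum, ← Finset.sum_sub_distrib]
      refine Finset.sum_congr rfl fun l _ => ?_
      simp
      ring
    have e2 : ⟪v.2, t i⟫ = v.2 * t i := by simp [mul_comm]
    rw [regress, inner_add_left, inner_smul_left, EuclideanSpace.inner_single_left, e1, e2]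
    simp
    ring
  rw [charFun_apply, integral_map (measurable_regress Ω i).aemeasurable
    (Measurable.aestronglyMeasurable (by fun_prop))]
  have hsplit : ∀ v : EuclideanSpace ℝ (Fin p) × ℝ,
      Complex.exp (⟪regress Ω i v, t⟫ * Complex.I) =
        Complex.exp (⟪v.1, u⟫ * Complex.I) * Complex.exp (⟪v.2, t i⟫ * Complex.I) := by
    intro v
    rw [hinner, ← Complex.exp_add]
    push_cast
    ring_nf
  simp_rw [hsplit]
  rw [integral_prod_mul (fun x : EuclideanSpace ℝ (Fin p) => Complex.exp (⟪x, u⟫ * Complex.I))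
    (fun y : ℝ => Complex.exp (⟪y, t i⟫ * Complex.I)), ← charFun_apply, ← charFun_apply,
    charFun_multivariateGaussian hS, charFun_multivariateGaussian hS, noiseLaw,
    charFun_gaussianReal, ← Complex.exp_add]
  -- Since `Ω⁻¹` maps row `i` of `Ω` to a basis vector, the missing term is exactly the noise
  -- variance times `t i ^ 2`.
  have hquad : u.ofLp ⬝ᵥ Ω⁻¹ *ᵥ u.ofLp = t.ofLp ⬝ᵥ Ω⁻¹ *ᵥ t.ofLp - (Ω i i)⁻¹ * t i ^ 2 := by
    have hrow : Ω⁻¹ *ᵥ Ω i = Pi.single i 1 := by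
      have : Ω i = Ω *ᵥ Pi.single i 1 := by
        funext l
        rw [mulVec_single_one]
        exact congrFun (congrFun hsymm l) i
      rw [this, mulVec_mulVec, nonsing_inv_mul _ hdet, one_mulVec]
    have hrow' : Ω i ⬝ᵥ Ω⁻¹ *ᵥ t.ofLp = t i := by
      rw [dotProduct_mulVec, ← mulVec_transpose, transpose_nonsing_inv, hsymm, hrow]
      simp
    rw [hu]
    simp only [mulVec_sub, mulVec_smul, hrow, sub_dotProduct, dotProduct_sub, smul_dotProduct,
      dotProduct_smul, hrow', dotProduct_single, mul_one, smul_eq_mul,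
      Pi.sub_apply, Pi.smul_apply]
    field_simp
    ring
  rw [hquad]
  congr 1
  rw [Real.coe_toNNReal _ (inv_nonneg.mpr hii.le)]
  push_cast
  simp
  ring

theorem memLp_coord (l : Fin p) {S : Matrix (Fin p) (Fin p) ℝ} :
    MemLp (fun x : EuclideanSpace ℝ (Fin p) => x l) 2 (multivariateGaussian 0 S) := by
  have h := IsGaussian.memLp_two_id (μ := multivariateGaussian (0 : EuclideanSpace ℝ (Fin p)) S)
  exact h.continuousLinearMap_comp (EuclideanSpace.proj l : EuclideanSpace ℝ (Fin p) →L[ℝ] ℝ)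

theorem integral_coord (l : Fin p) {S : Matrix (Fin p) (Fin p) ℝ} :
    ∫ x : EuclideanSpace ℝ (Fin p), x l ∂(multivariateGaussian 0 S) = 0 := by
  have h := (EuclideanSpace.proj l : EuclideanSpace ℝ (Fin p) →L[ℝ] ℝ).integral_comp_id_comm
    (IsGaussian.integrable_id (μ := multivariateGaussian (0 : EuclideanSpace ℝ (Fin p)) S))
  rw [integral_id_multivariateGaussian] at h
  simpa using h

theorem integral_coord_mul (hΩ : Ω.PosDef) (k l : Fin p) :
    ∫ x : EuclideanSpace ℝ (Fin p), x k * x l ∂(multivariateGaussian 0 Ω⁻¹) = Ω⁻¹ k l := by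
  have h := covariance_eval_multivariateGaussian (μ := (0 : EuclideanSpace ℝ (Fin p)))
    hΩ.inv.posSemidef k l
  rw [covariance_eq_sub (memLp_coord k) (memLp_coord l), integral_coord, zero_mul, sub_zero] at h
  exact h

/-- `(Ω x)_i` is orthogonal to functions that do not depend on coordinate `i`. -/
theorem integral_mul_residual (hΩ : Ω.PosDef) (i : Fin p) {h : EuclideanSpace ℝ (Fin p) → ℝ}
    (hh : Measurable h) (hi : ∀ v, h (regress Ω i v) = h v.1) :
    ∫ x, h x * ∑ l, Ω i l * x l ∂(multivariateGaussian 0 Ω⁻¹) = 0 := by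
  have hii : Ω i i ≠ 0 := hΩ.diag_pos.ne'
  -- After regression `(Ω x)_i` is a multiple of the noise alone, which is centered and independent
  -- of `v.1`.
  have hres : ∀ v, ∑ l, Ω i l * regress Ω i v l = Ω i i * v.2 := by
    intro v
    simp only [regress, PiLp.add_apply, PiLp.smul_apply, smul_eq_mul, mul_add,
      Finset.sum_add_distrib]
    have : ∀ r : ℝ, ∑ l, Ω i l * (r * (EuclideanSpace.single i (1 : ℝ) :
        EuclideanSpace ℝ (Fin p)) l) = Ω i i * r := by
      intro r
      rw [Finset.sum_eq_single i]
      · simp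
      · intro l _ hl
        simp [hl]
      · simp
    rw [this]
    field_simp
    ring
  rw [← map_regress hΩ i, integral_map (measurable_regress Ω i).aemeasurable
    (Measurable.aestronglyMeasurable (by fun_prop))]
  simp_rw [hi, hres]
  rw [integral_prod_mul h (fun e => Ω i i * e), integral_const_mul, noiseLaw]
  simp [integral_id_gaussianReal]

end GaussianRegression

/-! ### Conditional independence and zeros of the precision matrix -/

section ConditionalIndependence

/-- The conditional expectation of a product of conditionally independent functions. -/
theorem condExp_mul_of_condIndepFun {S : Type*} {m mS : MeasurableSpace S} [StandardBorelSpace S]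
    {hm : m ≤ mS} {μ : Measure S} [IsFiniteMeasure μ] {f g : S → ℝ} (hf : Measurable f)
    (hg : Measurable g) (hfi : Integrable f μ) (hgi : Integrable g μ)
    (hfg : Integrable (fun x => f x * g x) μ) (h : CondIndepFun m hm f g μ) :
    μ[fun x => f x * g x | m] =ᵐ[μ] μ[f | m] * μ[g | m] := by
  have h1 := ae_of_ae_trim hm ((condIndepFun_iff_map_prod_eq_prod_map_map hf hg).mp h)
  filter_upwards [h1, condExp_ae_eq_integral_condExpKernel hm hfi,
    condExp_ae_eq_integral_condExpKernel hm hgi,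
    condExp_ae_eq_integral_condExpKernel hm hfg] with x hx h2 h3 h4
  rw [Pi.mul_apply, h2, h3, h4]
  have hmul : AEStronglyMeasurable (fun z : ℝ × ℝ => z.1 * z.2)
      ((condExpKernel μ m x).map fun y => (f y, g y)) :=
    Measurable.aestronglyMeasurable (by fun_prop)
  rw [← integral_map (f := fun z : ℝ × ℝ => z.1 * z.2) (φ := fun y => (f y, g y))
    (by fun_prop) hmul, ← Kernel.map_apply _ (by fun_prop), hx, Kernel.prod_apply,
    integral_prod_mul (fun a : ℝ => a) (fun b : ℝ => b), Kernel.map_apply _ hf,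
    Kernel.map_apply _ hg, integral_map hf.aemeasurable (by fun_prop),
    integral_map hg.aemeasurable (by fun_prop)]

/-- Gives invariance of a conditional expectation at every point, not only almost everywhere. -/
theorem eq_of_measurable_comap {S T : Type*} [mT : MeasurableSpace T] {φ : S → T} {h : S → ℝ}
    (hh : Measurable[MeasurableSpace.comap φ mT] h) {x y : S} (hxy : φ x = φ y) : h x = h y := by
  obtain ⟨A, -, hA⟩ := hh (measurableSet_singleton (h y))
  have : y ∈ φ ⁻¹' A := by
    rw [hA]
    rfl
  have hx : x ∈ h ⁻¹' {h y} := by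
    rw [← hA, Set.mem_preimage, hxy]
    exact this
  exact hx

/-- The σ-algebra generated by the coordinates in `H`. -/
abbrev coordSigma {p : ℕ} (H : Set (Fin p)) : MeasurableSpace (EuclideanSpace ℝ (Fin p)) :=
  MeasurableSpace.comap (fun (x : EuclideanSpace ℝ (Fin p)) (k : H) => x k) inferInstance

theorem coordSigma_le {p : ℕ} (H : Set (Fin p)) :
    coordSigma H ≤ (inferInstance : MeasurableSpace (EuclideanSpace ℝ (Fin p))) :=
  Measurable.comap_le (by fun_prop)

/-- Conditional independence given all other coordinates forces a zero of the precision matrix. -/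
theorem eq_zero_of_condIndepCoord {p : ℕ} {Ω : Matrix (Fin p) (Fin p) ℝ} (hΩ : Ω.PosDef)
    {i j : Fin p} (hij : i ≠ j)
    (h : CondIndepCoord (multivariateGaussian 0 Ω⁻¹) ({i, j}ᶜ : Set (Fin p)) i j) :
    Ω i j = 0 := by
  set μ := multivariateGaussian (0 : EuclideanSpace ℝ (Fin p)) Ω⁻¹ with hμ
  have hle := coordSigma_le ({i, j}ᶜ : Set (Fin p))
  have hcond : CondIndepFun (coordSigma ({i, j}ᶜ : Set (Fin p))) hle
    (fun x : EuclideanSpace ℝ (Fin p) => x i) (fun x => x j) μ := h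
  have hdet : IsUnit Ω.det := (isUnit_iff_isUnit_det _).mp hΩ.isUnit
  have hsymm : Ω j i = Ω i j := by
    have := hΩ.isHermitian.apply i j
    simpa using this
  have hL := fun l => memLp_coord (p := p) (S := Ω⁻¹) l
  have hint := fun l => (hL l).integrable one_le_two
  have hint2 : ∀ k l : Fin p, Integrable (fun x : EuclideanSpace ℝ (Fin p) => x k * x l) μ :=
    fun k l => (hL k).integrable_mul (hL l)
  set f : EuclideanSpace ℝ (Fin p) → ℝ :=
    μ[fun x => x i | coordSigma ({i, j}ᶜ : Set (Fin p))] with hf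
  have hfm : Measurable[coordSigma ({i, j}ᶜ : Set (Fin p))] f :=
    stronglyMeasurable_condExp.measurable
  have hfm' : Measurable f := hfm.mono hle le_rfl
  have hfL : MemLp f 2 μ := (hL i).condExp one_le_two
  have hfint : ∀ l : Fin p, Integrable (fun x : EuclideanSpace ℝ (Fin p) => f x * x l) μ :=
    fun l => hfL.integrable_mul (hL l)
  -- In the moments against `x l`, `l ≠ i`, the conditional expectation `f` can replace `x i`: for
  -- `l = j` by conditional independence, otherwise because `x l` is measurable for the
  -- conditioning.
  have hpull : ∀ l, l ≠ i → ∫ x, f x * x l ∂μ = ∫ x, x i * x l ∂μ := by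
    intro l hl
    by_cases hlj : l = j
    · rw [hlj]
      have c1 := condExp_mul_of_condIndepFun (f := fun x : EuclideanSpace ℝ (Fin p) => x i)
        (g := fun x => x j) (by fun_prop) (by fun_prop) (hint i) (hint j) (hint2 i j) hcond
      have c2 : μ[fun x => f x * x j | coordSigma ({i, j}ᶜ : Set (Fin p))] =ᵐ[μ]
          f * μ[fun x => x j | coordSigma ({i, j}ᶜ : Set (Fin p))] :=
        condExp_mul_of_stronglyMeasurable_left stronglyMeasurable_condExp (hfint j) (hint j)
      rw [← integral_condExp hle (f := fun x => f x * x j),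
        ← integral_condExp hle (f := fun x => x i * x j)]
      exact integral_congr_ae (c2.trans c1.symm)
    · have hlm : StronglyMeasurable[coordSigma ({i, j}ᶜ : Set (Fin p))]
          fun x : EuclideanSpace ℝ (Fin p) => x l := by
        have : Measurable[coordSigma ({i, j}ᶜ : Set (Fin p))]
            fun x : EuclideanSpace ℝ (Fin p) => x l :=
          (measurable_pi_apply (⟨l, by simp [hl, hlj]⟩ : ({i, j}ᶜ : Set (Fin p)))).comp
            (comap_measurable
              (fun (x : EuclideanSpace ℝ (Fin p)) (k : ({i, j}ᶜ : Set (Fin p))) => x k))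
        exact this.stronglyMeasurable
      have c2 : μ[fun x => x i * x l | coordSigma ({i, j}ᶜ : Set (Fin p))] =ᵐ[μ] f * fun x => x l :=
        condExp_mul_of_stronglyMeasurable_right hlm (hint2 i l) (hint i)
      rw [← integral_condExp hle (f := fun x => x i * x l)]
      exact (integral_congr_ae c2).symm
  have hinv : ∀ a ∈ ({i, j} : Set (Fin p)), ∀ v, f (regress Ω a v) = f v.1 := by
    intro a ha v
    refine eq_of_measurable_comap hfm ?_
    funext k
    exact regress_apply_of_ne (fun hk => k.2 (by rw [hk]; exact ha)) v
  have hXres : ∀ a, ∫ x, x i * ∑ l, Ω a l * x l ∂μ = if a = i then 1 else 0 := by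
    intro a
    have e1 : ∀ x : EuclideanSpace ℝ (Fin p), x i * ∑ l, Ω a l * x l
        = ∑ l, Ω a l * (x l * x i) := fun x => by
      rw [Finset.mul_sum]
      exact Finset.sum_congr rfl fun l _ => by ring
    simp_rw [e1]
    rw [integral_finsetSum _ fun l _ => (hint2 l i).const_mul _]
    simp_rw [integral_const_mul, hμ, integral_coord_mul hΩ]
    have := congrFun (congrFun (mul_nonsing_inv _ hdet) a) i
    rw [mul_apply, one_apply] at this
    exact this
  -- Only the term `l = i` distinguishes `f` from `x i`. For `a = i, j` the left side vanishes, as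
  -- `f` ignores both coordinates. The case `a = i` shows that the difference of second moments is
  -- nonzero, and the case `a = j` then forces `Ω j i = 0`.
  have hfres : ∀ a, ∫ x, f x * ∑ l, Ω a l * x l ∂μ
      = (if a = i then 1 else 0) + Ω a i * (∫ x, f x * x i ∂μ - ∫ x, x i * x i ∂μ) := by
    intro a
    have e1 : ∀ (y : ℝ) (x : EuclideanSpace ℝ (Fin p)), y * ∑ l, Ω a l * x l
        = ∑ l, Ω a l * (y * x l) := fun y x => by
      rw [Finset.mul_sum]
      exact Finset.sum_congr rfl fun l _ => by ring
    rw [← hXres a]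
    simp_rw [e1]
    rw [integral_finsetSum _ fun l _ => (hint2 i l).const_mul _,
      integral_finsetSum _ fun l _ => (hfint l).const_mul _]
    simp_rw [integral_const_mul]
    rw [Fintype.sum_eq_add_sum_subtype_ne _ i,
      Fintype.sum_eq_add_sum_subtype_ne (fun l => Ω a l * ∫ x, x i * x l ∂μ) i]
    have : ∑ l : {l // l ≠ i}, Ω a l * ∫ x, f x * x l ∂μ
        = ∑ l : {l // l ≠ i}, Ω a l * ∫ x, x i * x l ∂μ :=
      Finset.sum_congr rfl fun l _ => by rw [hpull l l.2]
    rw [this]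
    ring
  have hi0 := integral_mul_residual hΩ i hfm' (hinv i (by simp))
  have hj0 := integral_mul_residual hΩ j hfm' (hinv j (by simp))
  rw [← hμ, hfres] at hi0 hj0
  rw [if_pos rfl] at hi0
  rw [if_neg hij.symm, zero_add, hsymm] at hj0
  rcases mul_eq_zero.mp hj0 with h0 | h0
  · exact h0
  · rw [h0] at hi0
    norm_num at hi0

theorem eq_zero_of_not_adj {p : ℕ} {Ω : Matrix (Fin p) (Fin p) ℝ} (hΩ : Ω.PosDef) {i j : Fin p}
    (hij : i ≠ j) (h : ¬ (trueGraph Ω).Adj i j) : Ω i j = 0 := by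
  refine eq_zero_of_condIndepCoord hΩ hij ?_
  by_contra hc
  exact h ⟨hij, hc⟩

end ConditionalIndependence

/-! ### Almost sure invertibility of the Gram matrices -/

section RowSpan

open scoped RealInnerProductSpace

variable {p : ℕ} {Ω : Matrix (Fin p) (Fin p) ℝ}

/-- A proper subspace lies in the kernel of a nonzero functional, whose law is Gaussian with
positive variance and so has no atoms. -/
theorem multivariateGaussian_submodule (hΩ : Ω.PosDef)
    {V : Submodule ℝ (EuclideanSpace ℝ (Fin p))} (hV : V ≠ ⊤) :
    multivariateGaussian 0 Ω⁻¹ (V : Set (EuclideanSpace ℝ (Fin p))) = 0 := by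
  set μ := multivariateGaussian (0 : EuclideanSpace ℝ (Fin p)) Ω⁻¹ with hμ
  obtain ⟨u, hu, hu0⟩ := (Submodule.ne_bot_iff _).mp
    (fun h => hV (Submodule.orthogonal_eq_bot_iff.mp h))
  set L : StrongDual ℝ (EuclideanSpace ℝ (Fin p)) := innerSL ℝ u with hL
  have hvar : 0 < Var[L; μ] := by
    have h1 := covarianceBilin_self (μ := μ) IsGaussian.memLp_two_id u
    rw [hμ, covarianceBilin_multivariateGaussian hΩ.inv.posSemidef] at h1
    have h2 : Var[L; μ] = u.ofLp ⬝ᵥ Ω⁻¹ *ᵥ u.ofLp := by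
      rw [h1]
      rfl
    rw [h2]
    have h3 := hΩ.inv.dotProduct_mulVec_pos (x := u.ofLp) (by
      intro h
      exact hu0 (by ext i; simpa using congrFun h i))
    simpa using h3
  have hmap := IsGaussian.map_eq_gaussianReal (μ := μ) L
  have hsub : (V : Set (EuclideanSpace ℝ (Fin p))) ⊆ L ⁻¹' {0} := by
    intro v hv
    have := Submodule.inner_left_of_mem_orthogonal hv hu
    simpa [hL] using this
  refine measure_mono_null hsub ?_
  rw [← Measure.map_apply (by fun_prop) (measurableSet_singleton 0), hmap]
  have hne : (Var[L; μ]).toNNReal ≠ 0 := by simpa using hvar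
  have := nullSingletonClass_gaussianReal (μ := μ[L]) hne
  exact measure_singleton _

theorem ae_linearIndependent_rows (hΩ : Ω.PosDef) (m : ℕ) (hm : m ≤ p) :
    ∀ᵐ x ∂(Measure.pi fun _ : Fin m => multivariateGaussian 0 Ω⁻¹), LinearIndependent ℝ x := by
  induction m with
  | zero => exact Filter.Eventually.of_forall fun x => linearIndependent_empty_type
  | succ m ih =>
    have hmp := measurePreserving_piFinSuccAbove
      (fun _ : Fin (m + 1) => multivariateGaussian (0 : EuclideanSpace ℝ (Fin p)) Ω⁻¹) 0
    have hcons : Measurable fun z : EuclideanSpace ℝ (Fin p) × (Fin m → EuclideanSpace ℝ (Fin p)) =>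
        (Fin.cons z.1 z.2 : Fin (m + 1) → EuclideanSpace ℝ (Fin p)) := by
      refine measurable_pi_lambda _ fun k => ?_
      cases k using Fin.cases with
      | zero => exact measurable_fst
      | succ k => exact (measurable_pi_apply k).comp measurable_snd
    have hset : MeasurableSet {z : EuclideanSpace ℝ (Fin p) × (Fin m → EuclideanSpace ℝ (Fin p)) |
        LinearIndependent ℝ (Fin.cons z.1 z.2 : Fin (m + 1) → EuclideanSpace ℝ (Fin p))} :=
      hcons isOpen_setOfPred_linearIndependent.measurableSet
    have hprod : ∀ᵐ z ∂((multivariateGaussian (0 : EuclideanSpace ℝ (Fin p)) Ω⁻¹).prod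
        (Measure.pi fun _ : Fin m => multivariateGaussian (0 : EuclideanSpace ℝ (Fin p)) Ω⁻¹)),
        LinearIndependent ℝ (Fin.cons z.1 z.2 : Fin (m + 1) → EuclideanSpace ℝ (Fin p)) := by
      -- Exchanging the order fixes the other `m < p` rows; the new row almost surely avoids their
      -- span.
      rw [Measure.ae_prod_iff_ae_ae hset, Measure.ae_ae_comm hset]
      filter_upwards [ih (by omega)] with v hv
      have hspan : Submodule.span ℝ (Set.range v) ≠ ⊤ := by
        intro h
        have h1 := finrank_span_eq_card hv
        rw [h, finrank_top, finrank_euclideanSpace_fin, Fintype.card_fin] at h1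
        omega
      have h0 := multivariateGaussian_submodule hΩ hspan
      filter_upwards [measure_eq_zero_iff_ae_notMem.mp h0] with a ha
      exact linearIndependent_finCons.mpr ⟨hv, ha⟩
    filter_upwards [hmp.quasiMeasurePreserving.ae hprod] with x hx
    have : (Fin.cons (x 0) (fun k => x k.succ) : Fin (m + 1) → EuclideanSpace ℝ (Fin p)) = x :=
      Fin.cons_self_tail x
    rw [← this]
    exact hx

theorem ae_span_rows_eq_top (hΩ : Ω.PosDef) (n : ℕ) (hn : p ≤ n) :
    ∀ᵐ x ∂(Measure.pi fun _ : Fin n => multivariateGaussian 0 Ω⁻¹),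
      Submodule.span ℝ (Set.range x) = ⊤ := by
  induction n, hn using Nat.le_induction with
  | base =>
    filter_upwards [ae_linearIndependent_rows hΩ p le_rfl] with x hx
    exact hx.span_eq_top_of_card_eq_finrank' (by simp)
  | succ m hm ih =>
    have hmp := measurePreserving_piFinSuccAbove
      (fun _ : Fin (m + 1) => multivariateGaussian (0 : EuclideanSpace ℝ (Fin p)) Ω⁻¹) 0
    have h2 := (Measure.quasiMeasurePreserving_snd (μ := multivariateGaussian
      (0 : EuclideanSpace ℝ (Fin p)) Ω⁻¹)).ae ih
    filter_upwards [hmp.quasiMeasurePreserving.ae h2] with x hx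
    rw [eq_top_iff, ← hx]
    refine Submodule.span_mono ?_
    rintro _ ⟨k, rfl⟩
    exact ⟨_, rfl⟩

/-- Removing a column leaves a design matrix with invertible Gram matrix. -/
theorem isUnit_gram_of_span_eq_top {n : ℕ} {x : Fin n → EuclideanSpace ℝ (Fin p)}
    (hx : Submodule.span ℝ (Set.range x) = ⊤) (i : Fin p) :
    IsUnit ((Matrix.of fun k (l : Others i) => x k l)ᵀ *
      (Matrix.of fun k (l : Others i) => x k l)) := by
  set D : Matrix (Fin n) (Others i) ℝ := Matrix.of fun k (l : Others i) => x k l with hD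
  rw [← mulVec_injective_iff_isUnit]
  rw [← coe_mulVecLin, ← LinearMap.ker_eq_bot, LinearMap.ker_eq_bot']
  intro v hv
  have hDv : D *ᵥ v = 0 := by
    have : Dᴴ * D = Dᵀ * D := by rw [conjTranspose_eq_transpose_of_trivial]
    rw [mulVecLin_apply, ← this, conjTranspose_mul_self_mulVec_eq_zero] at hv
    exact hv
  set w : EuclideanSpace ℝ (Fin p) := WithLp.toLp 2 fun l => if h : l ≠ i then v ⟨l, h⟩ else 0
    with hw
  have horth : ∀ k, ⟪x k, w⟫ = 0 := by
    intro k
    have h1 := congrFun hDv k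
    rw [PiLp.inner_apply, Fintype.sum_eq_add_sum_subtype_ne _ i]
    have h2 : ∀ l : {l // l ≠ i}, ⟪x k l, w l⟫ = D k l * v l := fun l => by
      simp [hw, hD, l.2, mul_comm]
    simp_rw [h2]
    have h3 : ⟪x k i, w i⟫ = 0 := by simp [hw]
    rw [h3, zero_add]
    exact h1
  have hw0 : w = 0 := by
    have : w ∈ (Submodule.span ℝ (Set.range x))ᗮ := by
      rw [Submodule.mem_orthogonal]
      intro u hu
      induction hu using Submodule.span_induction with
      | mem u hu => obtain ⟨k, rfl⟩ := hu; exact horth k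
      | zero => simp
      | add a b _ _ ha hb => rw [inner_add_left, ha, hb, add_zero]
      | smul r a _ ha => rw [inner_smul_left, ha, mul_zero]
    rw [hx, Submodule.top_orthogonal_eq_bot] at this
    exact this
  funext l
  have := congrArg (fun z : EuclideanSpace ℝ (Fin p) => z l) hw0
  simpa [hw, l.2] using this

end RowSpan

/-! ### The bound for one response variable -/

section NodeBound

variable {n p : ℕ} {Ω : Matrix (Fin p) (Fin p) ℝ}

theorem measurable_isometryAct (Q : EuclideanSpace ℝ (Fin n) ≃ₗᵢ[ℝ] EuclideanSpace ℝ (Fin n)) :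
    Measurable (isometryAct Q) :=
  (WithLp.measurable_ofLp 2 _).comp (Q.continuous.measurable.comp (WithLp.measurable_toLp 2 _))

theorem map_isometryAct_pi_gaussianReal_one
    (Q : EuclideanSpace ℝ (Fin n) ≃ₗᵢ[ℝ] EuclideanSpace ℝ (Fin n)) :
    (Measure.pi fun _ : Fin n => gaussianReal 0 1).map (isometryAct Q) =
      Measure.pi fun _ : Fin n => gaussianReal 0 1 := by
  have h1 := map_pi_eq_stdGaussian (ι := Fin n)
  have h2 := stdGaussian_map Q
  have h3 : (stdGaussian (EuclideanSpace ℝ (Fin n))).map WithLp.ofLp =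
      Measure.pi fun _ : Fin n => gaussianReal 0 1 := by
    rw [← h1, Measure.map_map (WithLp.measurable_ofLp 2 _) (WithLp.measurable_toLp 2 _)]
    exact Measure.map_id
  conv_rhs => rw [← h3, ← h2, ← h1]
  rw [Measure.map_map Q.continuous.measurable (WithLp.measurable_toLp 2 _),
    Measure.map_map (WithLp.measurable_ofLp 2 _)
      (Q.continuous.measurable.comp (WithLp.measurable_toLp 2 _))]
  rfl

/-- Independent centered Gaussian noise is invariant under linear isometries. -/
theorem map_isometryAct_pi_noiseLaw (i : Fin p)
    (Q : EuclideanSpace ℝ (Fin n) ≃ₗᵢ[ℝ] EuclideanSpace ℝ (Fin n)) :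
    (Measure.pi fun _ : Fin n => noiseLaw Ω i).map (isometryAct Q) =
      Measure.pi fun _ : Fin n => noiseLaw Ω i := by
  set v := (Ω i i)⁻¹.toNNReal with hv
  have hscale : MeasurePreserving (fun y : ℝ => √v * y) (gaussianReal 0 1) (noiseLaw Ω i) := by
    refine ⟨by fun_prop, ?_⟩
    rw [gaussianReal_map_const_mul, noiseLaw, ← hv, mul_zero]
    congr 1
    ext
    simp
  have hpi := measurePreserving_pi (fun _ : Fin n => gaussianReal 0 1)
    (fun _ : Fin n => noiseLaw Ω i) fun _ => hscale
  have hcomm : isometryAct Q ∘ (fun (y : Fin n → ℝ) k => √v * y k) =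
      (fun (y : Fin n → ℝ) k => √v * y k) ∘ isometryAct Q := by
    funext y
    exact isometryAct_smul Q (√v) y
  rw [← hpi.map_eq, Measure.map_map (measurable_isometryAct Q) hpi.measurable, hcomm,
    ← Measure.map_map hpi.measurable (measurable_isometryAct Q),
    map_isometryAct_pi_gaussianReal_one]

/-- The data matrix as a function of the predictors and the noise of the regression of coordinate
`i` on the others. -/
theorem measurePreserving_regress_rows (hΩ : Ω.PosDef) (n : ℕ) (i : Fin p) :
    MeasurePreserving (fun (v : (Fin n → EuclideanSpace ℝ (Fin p)) × (Fin n → ℝ)) k =>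
        regress Ω i (v.1 k, v.2 k))
      ((Measure.pi fun _ : Fin n => multivariateGaussian 0 Ω⁻¹).prod
        (Measure.pi fun _ : Fin n => noiseLaw Ω i))
      (Measure.pi fun _ : Fin n => multivariateGaussian 0 Ω⁻¹) := by
  have h1 := (measurePreserving_arrowProdEquivProdArrow (EuclideanSpace ℝ (Fin p)) ℝ (Fin n)
    (fun _ => multivariateGaussian 0 Ω⁻¹) (fun _ => noiseLaw Ω i)).symm
  have h2 := measurePreserving_pi
    (fun _ : Fin n => (multivariateGaussian 0 Ω⁻¹).prod (noiseLaw Ω i))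
    (fun _ : Fin n => multivariateGaussian 0 Ω⁻¹)
    fun _ => ⟨measurable_regress Ω i, map_regress hΩ i⟩
  exact h2.comp h1

variable {σ : ColumnScaling}
  {knock : ∀ i : Fin p, Matrix (Fin n) (Others i) ℝ → Matrix (Fin n) (Others i) ℝ}
  {P : ∀ i : Fin p, FeatureProcedure n (Others i)}

/-- Exhibits the design as a function of `z` alone, so that with `z` fixed only the response is
random. -/
theorem featureStat_regress (hΩ : Ω.PosDef) (i : Fin p) (z : Fin n → EuclideanSpace ℝ (Fin p))
    (e : Fin n → ℝ) (l : Fin p) :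
    featureStat σ knock P (fun k => regress Ω i (z k, e k)) i l =
      if h : l ≠ i then
        P i (σ.apply (Matrix.of fun k (l : Others i) => z k l))
          (knock i (σ.apply (Matrix.of fun k (l : Others i) => z k l)))
          ((Matrix.of fun k (l : Others i) => z k l) *ᵥ
            (fun l : Others i => -(Ω i l / Ω i i)) + e) ⟨l, h⟩
      else 0 := by
  have hD : (Matrix.of fun k (l : Others i) => regress Ω i (z k, e k) l) =
      Matrix.of fun k (l : Others i) => z k l := by
    ext k l
    exact regress_apply_of_ne l.2 _
  have hy : (fun k => regress Ω i (z k, e k) i) =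
      (Matrix.of fun k (l : Others i) => z k l) *ᵥ
        (fun l : Others i => -(Ω i l / Ω i i)) + e := by
    funext k
    rw [regress_apply_self hΩ.diag_pos.ne']
    rfl
  unfold featureStat
  simp only [hD, hy]

/-- The mean of the largest ratio of the positive to the negative count of null variables in the
feature statistics of one response variable. -/
theorem lintegral_signRatio_featureStat_le (hΩ : Ω.PosDef) (hnp : p ≤ n) {a c : ℝ}
    (hac : (a = 1 ∧ c = 1.93) ∨ (a = 0.01 ∧ c = 102)) {O : Strategy} (i : Fin p)
    (hknock : ∀ D : Matrix (Fin n) (Others i) ℝ, IsUnit (Dᵀ * D) →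
      IsConstructedKnockoff O D (knock i D))
    (hs : (P i).Sufficient) (ha : (P i).Antisymmetric)
    (hW : Measurable fun x : Fin n → EuclideanSpace ℝ (Fin p) => featureStat σ knock P x i)
    (H : Finset (Fin p)) (hH : ∀ j ∈ H, j ≠ i ∧ Ω i j = 0) :
    ∫⁻ x, signRatio a H (featureStat σ knock P x i)
      ∂(Measure.pi fun _ : Fin n => multivariateGaussian 0 Ω⁻¹) ≤ ENNReal.ofReal c := by
  have hF := measurePreserving_regress_rows hΩ n i
  have hM := (measurable_signRatio a H).comp hW
  have h1 := hF.lintegral_comp hM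
  have hMF := hM.comp hF.measurable
  simp only [Function.comp_def] at h1 hMF
  rw [← h1, lintegral_prod _ hMF.aemeasurable]
  have hae := ae_span_rows_eq_top hΩ n hnp
  calc ∫⁻ z, ∫⁻ e, signRatio a H (featureStat σ knock P (fun k => regress Ω i (z k, e k)) i)
          ∂(Measure.pi fun _ : Fin n => noiseLaw Ω i)
          ∂(Measure.pi fun _ : Fin n => multivariateGaussian 0 Ω⁻¹)
      ≤ ∫⁻ z, ENNReal.ofReal c ∂(Measure.pi fun _ : Fin n => multivariateGaussian 0 Ω⁻¹) := by
        refine lintegral_mono_ae ?_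
        filter_upwards [hae] with z hz
        have hWz : Measurable fun e : Fin n → ℝ =>
            featureStat σ knock P (fun k => regress Ω i (z k, e k)) i :=
          hW.comp (hF.measurable.comp measurable_prodMk_left)
        refine lintegral_signRatio_le hWz hac H fun j hj => ?_
        obtain ⟨hji, hΩij⟩ := hH j hj
        obtain ⟨Q, hQ⟩ := exists_isometry_flip hs ha σ hknock
          (isUnit_gram_of_span_eq_top hz i) (fun l : Others i => -(Ω i l / Ω i i))
          (j := ⟨j, hji⟩) (by simp [hΩij])
        -- `Q` depends on `z` but not on `e`: the sign change is a measure-preserving change of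
        -- variables in the noise.
        have hflip : (fun e : Fin n → ℝ => flip {j}
            (featureStat σ knock P (fun k => regress Ω i (z k, e k)) i)) =
            (fun e => featureStat σ knock P (fun k => regress Ω i (z k, e k)) i) ∘
              isometryAct Q := by
          funext e l
          simp only [Function.comp_apply, flip, Finset.mem_singleton]
          rw [featureStat_regress hΩ, featureStat_regress hΩ]
          by_cases hl : l ≠ i
          · rw [dif_pos hl, dif_pos hl, hQ]
            simp [flip]
          · rw [dif_neg hl, dif_neg hl]
            simp
        rw [hflip, ← Measure.map_map hWz (measurable_isometryAct Q), map_isometryAct_pi_noiseLaw]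
    _ = ENNReal.ofReal c := by simp

end NodeBound

/-! ### Selected thresholds and sign ratios -/

section Thresholds

variable {p : ℕ}

theorem nodeThreshold_mem_candidates (w : Fin p → ℝ) (m : ℕ) :
    nodeThreshold w m ∈ candidates w := by
  have htop : (⊤ : EReal) ∈ (candidates w).filter fun t => (Vminus w t).card ≤ m := by
    refine Finset.mem_filter.mpr ⟨?_, ?_⟩
    · rw [candidates, Finset.mem_sdiff]
      exact ⟨Finset.mem_insert_self _ _, by simp⟩
    · have : Vminus w ⊤ = ∅ := by simp [Vminus]
      simp [this]
  obtain ⟨t, ht, h⟩ := Finset.exists_mem_eq_inf _ ⟨_, htop⟩ (id : EReal → EReal)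
  unfold nodeThreshold
  rw [h]
  exact (Finset.mem_filter.mp ht).1

theorem searchThreshold_spec (W : Fin p → Fin p → ℝ) (q δ a c : ℝ) (R : Rule) (m : ℕ) :
    (Feasible W q δ a c R (searchThreshold W q δ a c R m) ∧
      ∀ i, searchThreshold W q δ a c R m i ∈ candidates (W i)) ∨
    searchThreshold W q δ a c R m = fun _ => ⊤ := by
  induction m with
  | zero =>
    unfold searchThreshold
    split_ifs with h
    · exact Or.inl ⟨h, fun i => nodeThreshold_mem_candidates _ _⟩
    · exact Or.inr rfl
  | succ m ih =>
    unfold searchThreshold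
    split_ifs with h
    · exact Or.inl ⟨h, fun i => nodeThreshold_mem_candidates _ _⟩
    · exact ih

theorem thresholds_spec (W : Fin p → Fin p → ℝ) (q δ a c : ℝ) (R : Rule) :
    (Feasible W q δ a c R (thresholds W q δ a c R) ∧
      ∀ i, thresholds W q δ a c R i ∈ candidates (W i)) ∨
    thresholds W q δ a c R = fun _ => ⊤ := by
  unfold thresholds
  split_ifs with h
  · exact Or.inr rfl
  · exact searchThreshold_spec W q δ a c R _

theorem candidate_cases {w : Fin p → ℝ} {T : EReal} (h : T ∈ candidates w) :
    T = ⊤ ∨ ∃ j, w j ≠ 0 ∧ T = ((|w j| : ℝ) : EReal) := by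
  simp only [candidates, Finset.mem_sdiff, Finset.mem_insert, Finset.mem_image, Finset.mem_univ,
    true_and, Finset.mem_singleton] at h
  obtain ⟨h | ⟨j, rfl⟩, h0⟩ := h
  · exact Or.inl h
  · refine Or.inr ⟨j, fun hj => h0 ?_, rfl⟩
    simp [hj]

theorem Vplus_top (w : Fin p → ℝ) : Vplus w ⊤ = ∅ := by
  simp [Vplus]

/-- The number of selected null variables at a candidate threshold. -/
theorem card_Vplus_inter_le {a : ℝ} (ha : 0 < a) (H : Finset (Fin p)) (w : Fin p → ℝ) {T : EReal}
    (hT : T ∈ candidates w) :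
    ((Vplus w T ∩ H).card : ℝ≥0∞) ≤
      signRatio a H w * ENNReal.ofReal (a + (Vminus w T).card) := by
  rcases candidate_cases hT with rfl | ⟨j, hj, rfl⟩
  · simp [Vplus_top]
  · have h1 : (Vplus w ((|w j| : ℝ) : EReal) ∩ H).card = posCount H w |w j| := by
      unfold posCount Vplus
      congr 1
      ext k
      simp only [Finset.mem_inter, Finset.mem_filter, Finset.mem_univ, true_and,
        EReal.coe_le_coe_iff]
      tauto
    -- `Vminus` counts non-null variables as well, which only helps.
    have h2 : negCount H w |w j| ≤ (Vminus w ((|w j| : ℝ) : EReal)).card := by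
      unfold negCount Vminus
      refine Finset.card_le_card fun k hk => ?_
      rw [Finset.mem_filter] at hk ⊢
      refine ⟨Finset.mem_univ _, ?_⟩
      rw [← EReal.coe_neg, EReal.coe_le_coe_iff]
      exact hk.2
    have h2' : (negCount H w |w j| : ℝ) ≤ (Vminus w ((|w j| : ℝ) : EReal)).card := by
      exact_mod_cast h2
    have hpos : 0 < a + (negCount H w |w j| : ℝ) := by positivity
    calc ((Vplus w ((|w j| : ℝ) : EReal) ∩ H).card : ℝ≥0∞)
        = ENNReal.ofReal (posCount H w |w j| / (a + negCount H w |w j|)) *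
            ENNReal.ofReal (a + negCount H w |w j|) := by
          rw [← ENNReal.ofReal_mul (by positivity), div_mul_cancel₀ _ hpos.ne', h1,
            ENNReal.ofReal_natCast]
      _ ≤ _ := by
          gcongr
          exact le_signRatio a H w hj

end Thresholds

/-! ### Counting false edges -/

section Edges

variable {p : ℕ}

/-- The variables that are not adjacent to `i`. -/
def nonNeighbors (G : SimpleGraph (Fin p)) (i : Fin p) : Finset (Fin p) := by
  classical exact Finset.univ.filter fun j => j ≠ i ∧ ¬ G.Adj i j

theorem mem_nonNeighbors {G : SimpleGraph (Fin p)} {i j : Fin p} :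
    j ∈ nonNeighbors G i ↔ j ≠ i ∧ ¬ G.Adj i j := by
  simp [nonNeighbors]

/-- The number of selections per edge that the rule guarantees, inverted. -/
def ruleWeight : Rule → ℝ≥0∞
  | .and => 2⁻¹
  | .or => 1

theorem numEdges_mono {G G' : SimpleGraph (Fin p)} (h : G ≤ G') : numEdges G ≤ numEdges G' :=
  Set.ncard_le_ncard (SimpleGraph.edgeSet_mono h) (Set.toFinite _)

/-- Under AND both ends select a false edge, and the degree sum gives the factor one half. Under OR
every false edge is the image of at least one selection. -/
theorem numEdges_sdiff_le (W : Fin p → Fin p → ℝ) (R : Rule) (T : Fin p → EReal)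
    (G : SimpleGraph (Fin p)) :
    (numEdges (estGraph W R T \ G) : ℝ≥0∞) ≤
      ruleWeight R * ∑ i, ((Vplus (W i) (T i) ∩ nonNeighbors G i).card : ℝ≥0∞) := by
  classical
  cases R with
  | and =>
    set F := estGraph W .and T \ G with hF
    have hdeg : ∀ i, F.degree i ≤ (Vplus (W i) (T i) ∩ nonNeighbors G i).card := by
      intro i
      rw [← SimpleGraph.card_neighborFinset_eq_degree]
      refine Finset.card_le_card fun j hj => ?_
      rw [SimpleGraph.mem_neighborFinset, hF, SimpleGraph.sdiff_adj] at hj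
      obtain ⟨⟨h1, -, h2⟩, h3⟩ := hj
      exact Finset.mem_inter.mpr ⟨h2, mem_nonNeighbors.mpr ⟨h1.symm, h3⟩⟩
    have hsum : ∑ i, F.degree i = 2 * numEdges F := by
      rw [F.sum_degrees_eq_twice_card_edges, numEdges, ← SimpleGraph.coe_edgeFinset,
        Set.ncard_coe_finset]
      congr!
    have h2 : 2 * numEdges F ≤ ∑ i, (Vplus (W i) (T i) ∩ nonNeighbors G i).card := by
      rw [← hsum]
      exact Finset.sum_le_sum fun i _ => hdeg i
    have h2' : (2 : ℝ≥0∞) * numEdges F ≤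
        ∑ i, ((Vplus (W i) (T i) ∩ nonNeighbors G i).card : ℝ≥0∞) := by
      exact_mod_cast h2
    calc (numEdges F : ℝ≥0∞) = 2⁻¹ * (2 * numEdges F) := by
          rw [← mul_assoc, ENNReal.inv_mul_cancel (by simp) (by simp), one_mul]
      _ ≤ _ := by
          unfold ruleWeight
          gcongr
  | or =>
    set F := estGraph W .or T \ G with hF
    set A : Finset (Σ _ : Fin p, Fin p) :=
      Finset.univ.sigma fun i => Vplus (W i) (T i) ∩ nonNeighbors G i with hA
    have hsub : F.edgeSet ⊆ ((A.image fun s => s(s.1, s.2) : Finset (Sym2 (Fin p))) :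
        Set (Sym2 (Fin p))) := by
      intro e he
      induction e using Sym2.ind with
      | _ i j =>
        rw [SimpleGraph.mem_edgeSet, hF, SimpleGraph.sdiff_adj] at he
        obtain ⟨⟨h1, h2⟩, h3⟩ := he
        rw [Finset.mem_coe, Finset.mem_image]
        rcases h2 with h2 | h2
        · exact ⟨⟨j, i⟩, by simp [hA, h2, mem_nonNeighbors, h1, SimpleGraph.adj_comm, h3],
            Sym2.eq_swap⟩
        · exact ⟨⟨i, j⟩, by simp [hA, h2, mem_nonNeighbors, h1.symm, h3], rfl⟩
    have h1 : numEdges F ≤ A.card := by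
      refine (Set.ncard_le_ncard hsub (Set.toFinite _)).trans ?_
      rw [Set.ncard_coe_finset]
      exact Finset.card_image_le
    rw [hA, Finset.card_sigma] at h1
    rw [ruleWeight, one_mul]
    exact_mod_cast h1

theorem estGraph_top (W : Fin p → Fin p → ℝ) (R : Rule) : estGraph W R (fun _ => ⊤) = ⊥ := by
  cases R <;> ext i j <;> simp [estGraph, Vplus_top]

theorem numEdges_bot : numEdges (⊥ : SimpleGraph (Fin p)) = 0 := by
  simp [numEdges]

/-- The false discovery ratio is dominated by the sign ratios of the nodes. -/
theorem ratio_le_sum_signRatio (W : Fin p → Fin p → ℝ) (R : Rule) (G : SimpleGraph (Fin p))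
    {q a c : ℝ} (ha : 0 < a) (hlevel : 0 < level R p q c) :
    (numEdges (estGraph W R (thresholds W q 0 a c R) \ G) : ℝ≥0∞) /
        (numEdges (estGraph W R (thresholds W q 0 a c R)) + ENNReal.ofReal (a / level R p q c)) ≤
      ruleWeight R * ENNReal.ofReal (level R p q c) *
        ∑ i, signRatio a (nonNeighbors G i) (W i) := by
  set T := thresholds W q 0 a c R with hT
  set r := level R p q c with hr
  set E := numEdges (estGraph W R T) with hE
  have hmono : numEdges (estGraph W R T \ G) ≤ E := numEdges_mono sdiff_le
  rcases Nat.eq_zero_or_pos E with hE0 | hE0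
  · rw [hE0, Nat.le_zero] at hmono
    rw [hmono]
    simp
  have hEr : (1 : ℝ) ≤ E := by exact_mod_cast hE0
  rcases thresholds_spec W q 0 a c R with ⟨hfeas, hcand⟩ | htop
  swap
  · rw [← hT] at htop
    rw [hE, htop, estGraph_top, numEdges_bot] at hE0
    exact (lt_irrefl 0 hE0).elim
  rw [← hT] at hfeas hcand
  -- The constraint reads `|V_i^-| ≤ r E`; the offset `a / r` in the denominator pays for the extra
  -- `a`.
  have hminus : ∀ i, a + ((Vminus (W i) (T i)).card : ℝ) ≤ r * (E + a / r) := by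
    intro i
    have h1 := hfeas i
    rw [← hE, ← hr, max_eq_left hEr, mul_zero, zero_add, div_le_iff₀ (by linarith)] at h1
    rw [mul_add, mul_div_cancel₀ _ hlevel.ne']
    linarith
  have hden : (E : ℝ≥0∞) + ENNReal.ofReal (a / r) = ENNReal.ofReal (E + a / r) := by
    rw [ENNReal.ofReal_add (by positivity) (by positivity), ENNReal.ofReal_natCast]
  rw [hden]
  refine ENNReal.div_le_of_le_mul ?_
  calc (numEdges (estGraph W R T \ G) : ℝ≥0∞)
      ≤ ruleWeight R * ∑ i, ((Vplus (W i) (T i) ∩ nonNeighbors G i).card : ℝ≥0∞) :=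
        numEdges_sdiff_le W R T G
    _ ≤ ruleWeight R * ∑ i, signRatio a (nonNeighbors G i) (W i) *
          ENNReal.ofReal (r * (E + a / r)) := by
        gcongr with i _
        refine (card_Vplus_inter_le ha _ _ (hcand i)).trans ?_
        gcongr
        exact hminus i
    _ = _ := by
        rw [← Finset.sum_mul, ENNReal.ofReal_mul hlevel.le]
        ring

end Edges

/-! ### Expectation of the pointwise bound -/

section FDR

/-- Integrating the pointwise bound requires measurability of the sign ratios only, since the lower
integral is monotone for arbitrary functions. -/
theorem mFDR_knockoffFilter_le {S : Type*} [MeasurableSpace S] (μ : Measure S)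
    [IsProbabilityMeasure μ] {n p : ℕ} (hnp : p ≤ n) (hp : 0 < p)
    {Ω : Matrix (Fin p) (Fin p) ℝ} (hΩ : Ω.PosDef)
    {X : Fin n → S → EuclideanSpace ℝ (Fin p)}
    (hX_law : ∀ k, HasLaw (X k) (multivariateGaussian 0 Ω⁻¹) μ)
    (hX_indep : iIndepFun X μ) {q : ℝ} (hq : 0 < q) {a c : ℝ}
    (hac : (a = 1 ∧ c = 1.93) ∨ (a = 0.01 ∧ c = 102))
    {O : Strategy} {σ : ColumnScaling}
    {knock : ∀ i : Fin p, Matrix (Fin n) (Others i) ℝ → Matrix (Fin n) (Others i) ℝ}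
    (hknock : ∀ (i : Fin p) (D : Matrix (Fin n) (Others i) ℝ),
      IsUnit (Dᵀ * D) → IsConstructedKnockoff O D (knock i D))
    {P : ∀ i : Fin p, FeatureProcedure n (Others i)}
    (hP_suff : ∀ i, (P i).Sufficient) (hP_anti : ∀ i, (P i).Antisymmetric)
    (hW_meas : ∀ i, Measurable fun x : Fin n → EuclideanSpace ℝ (Fin p) =>
      featureStat σ knock P x i) (R : Rule) :
    mFDR μ (fun ω => knockoffFilter q 0 a c σ knock P R (fun k => X k ω)) (trueGraph Ω)
      (ENNReal.ofReal (a / level R p q c)) ≤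
        ruleWeight R * ENNReal.ofReal (level R p q c) * (p * ENNReal.ofReal c) := by
  have ha : 0 < a := by rcases hac with ⟨rfl, -⟩ | ⟨rfl, -⟩ <;> norm_num
  have hc : 0 < c := by rcases hac with ⟨-, rfl⟩ | ⟨-, rfl⟩ <;> norm_num
  have hlevel : 0 < level R p q c := by cases R <;> simp only [level] <;> positivity
  set G := trueGraph Ω with hG
  have hXm : ∀ k, AEMeasurable (X k) μ := fun k => (hX_law k).aemeasurable
  have hmap : μ.map (fun ω k => X k ω) =
      Measure.pi fun _ : Fin n => multivariateGaussian 0 Ω⁻¹ := by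
    rw [(iIndepFun_iff_map_fun_eq_pi_map hXm).mp hX_indep]
    congr 1
    funext k
    exact (hX_law k).map_eq
  have hmeas : ∀ i, Measurable fun x : Fin n → EuclideanSpace ℝ (Fin p) =>
      signRatio a (nonNeighbors G i) (featureStat σ knock P x i) :=
    fun i => (measurable_signRatio _ _).comp (hW_meas i)
  calc mFDR μ (fun ω => knockoffFilter q 0 a c σ knock P R (fun k => X k ω)) G
        (ENNReal.ofReal (a / level R p q c))
      ≤ ∫⁻ ω, ruleWeight R * ENNReal.ofReal (level R p q c) *
          ∑ i, signRatio a (nonNeighbors G i) (featureStat σ knock P (fun k => X k ω) i) ∂μ :=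
        lintegral_mono fun ω => ratio_le_sum_signRatio _ R G ha hlevel
    _ = ∫⁻ x, ruleWeight R * ENNReal.ofReal (level R p q c) *
          ∑ i, signRatio a (nonNeighbors G i) (featureStat σ knock P x i)
          ∂(Measure.pi fun _ : Fin n => multivariateGaussian 0 Ω⁻¹) := by
        rw [← hmap, lintegral_map' (Measurable.aemeasurable ?_) (aemeasurable_pi_lambda _ hXm)]
        exact (Finset.measurable_fun_sum _ fun i _ => hmeas i).const_mul _
    _ = ruleWeight R * ENNReal.ofReal (level R p q c) *
          ∑ i, ∫⁻ x, signRatio a (nonNeighbors G i) (featureStat σ knock P x i)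
          ∂(Measure.pi fun _ : Fin n => multivariateGaussian 0 Ω⁻¹) := by
        rw [lintegral_const_mul _ (Finset.measurable_fun_sum _ fun i _ => hmeas i),
          lintegral_finsetSum _ fun i _ => hmeas i]
    _ ≤ ruleWeight R * ENNReal.ofReal (level R p q c) * ∑ _i : Fin p, ENNReal.ofReal c := by
        gcongr with i _
        refine lintegral_signRatio_featureStat_le hΩ hnp hac i (hknock i) (hP_suff i) (hP_anti i)
          (hW_meas i) _ fun j hj => ?_
        obtain ⟨h1, h2⟩ := mem_nonNeighbors.mp hj
        exact ⟨h1, eq_zero_of_not_adj hΩ h1.symm h2⟩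
    _ = _ := by simp

theorem mFDR_eq_zero_of_top {S : Type*} [MeasurableSpace S] (μ : Measure S) {p : ℕ}
    (Ehat : S → SimpleGraph (Fin p)) (G : SimpleGraph (Fin p)) : mFDR μ Ehat G ∞ = 0 := by
  simp [mFDR]

theorem mFDR_eq_zero_of_isEmpty {S : Type*} [MeasurableSpace S] (μ : Measure S)
    (Ehat : S → SimpleGraph (Fin 0)) (G : SimpleGraph (Fin 0)) (b : ℝ≥0∞) :
    mFDR μ Ehat G b = 0 := by
  have : ∀ G : SimpleGraph (Fin 0), numEdges G = 0 := fun G => by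
    rw [Subsingleton.elim G ⊥, numEdges_bot]
  simp [mFDR, this]

end FDR

end GGMKnockoff

end

theorem theorem2 {S : Type*} [MeasurableSpace S] (μ : Measure S) [IsProbabilityMeasure μ]
    (n p : ℕ) (hnp : 2 * p ≤ n)
    (Ω : Matrix (Fin p) (Fin p) ℝ) (hΩ : Ω.PosDef)
    (X : Fin n → S → EuclideanSpace ℝ (Fin p))
    (hX_law : ∀ k, HasLaw (X k) (multivariateGaussian 0 Ω⁻¹) μ)
    (hX_indep : iIndepFun X μ)
    (q : ℝ) (hq0 : 0 ≤ q) (hq1 : q ≤ 1)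
    (a c : ℝ) (hac : (a = 1 ∧ c = 1.93) ∨ (a = 0.01 ∧ c = 102))
    (O : GGMKnockoff.Strategy) (σ : GGMKnockoff.ColumnScaling)
    (knock : ∀ i : Fin p, Matrix (Fin n) (GGMKnockoff.Others i) ℝ →
      Matrix (Fin n) (GGMKnockoff.Others i) ℝ)
    (hknock : ∀ (i : Fin p) (D : Matrix (Fin n) (GGMKnockoff.Others i) ℝ),
      IsUnit (Dᵀ * D) → GGMKnockoff.IsConstructedKnockoff O D (knock i D))
    (P : ∀ i : Fin p, GGMKnockoff.FeatureProcedure n (GGMKnockoff.Others i))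
    (hP_suff : ∀ i, (P i).Sufficient) (hP_anti : ∀ i, (P i).Antisymmetric)
    (hW_meas : ∀ i, Measurable fun x : Fin n → EuclideanSpace ℝ (Fin p) =>
      GGMKnockoff.featureStat σ knock P x i) :
    GGMKnockoff.mFDR μ
        (fun ω => GGMKnockoff.knockoffFilter q 0 a c σ knock P .and (fun k => X k ω))
        (GGMKnockoff.trueGraph Ω)
        (ENNReal.ofReal (a * c * p) / ENNReal.ofReal (2 * q)) ≤ ENNReal.ofReal q ∧
    GGMKnockoff.mFDR μ
        (fun ω => GGMKnockoff.knockoffFilter q 0 a c σ knock P .or (fun k => X k ω))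
        (GGMKnockoff.trueGraph Ω)
        (ENNReal.ofReal (a * c * p) / ENNReal.ofReal q) ≤ ENNReal.ofReal q := by
  rcases Nat.eq_zero_or_pos p with rfl | hp
  · simp [GGMKnockoff.mFDR_eq_zero_of_isEmpty]
  have ha : 0 < a := by rcases hac with ⟨rfl, -⟩ | ⟨rfl, -⟩ <;> norm_num
  have hc : 0 < c := by rcases hac with ⟨-, rfl⟩ | ⟨-, rfl⟩ <;> norm_num
  have hpr : (0 : ℝ) < p := by exact_mod_cast hp
  -- For `q = 0` the offset is a positive number divided by zero, hence `∞`, and the ratios vanish.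
  rcases hq0.eq_or_lt with rfl | hq
  · have h0 : ENNReal.ofReal (a * c * p) ≠ 0 := by
      rw [Ne, ENNReal.ofReal_eq_zero, not_le]
      positivity
    simp [ENNReal.div_zero h0, GGMKnockoff.mFDR_eq_zero_of_top]
  have key := GGMKnockoff.mFDR_knockoffFilter_le μ (show p ≤ n by omega) hp hΩ hX_law hX_indep hq
    hac hknock hP_suff hP_anti hW_meas
  constructor
  · rw [← ENNReal.ofReal_div_of_pos (by positivity)]
    have hb : a * c * p / (2 * q) = a / GGMKnockoff.level .and p q c := by
      simp only [GGMKnockoff.level]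
      field_simp
    rw [hb]
    -- The constants cancel: `1/2 · 2q/(c p) · p c = q`.
    refine (key .and).trans (le_of_eq ?_)
    have h2 : GGMKnockoff.ruleWeight .and = ENNReal.ofReal 2⁻¹ := by
      rw [ENNReal.ofReal_inv_of_pos two_pos]
      simp [GGMKnockoff.ruleWeight]
    have hlev : 0 ≤ GGMKnockoff.level .and p q c := by
      simp only [GGMKnockoff.level]
      positivity
    rw [h2, ← ENNReal.ofReal_natCast p, ← ENNReal.ofReal_mul (by positivity),
      ← ENNReal.ofReal_mul (by positivity), ← ENNReal.ofReal_mul (by positivity)]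
    congr 1
    simp only [GGMKnockoff.level]
    field_simp
  · rw [← ENNReal.ofReal_div_of_pos hq]
    have hb : a * c * p / q = a / GGMKnockoff.level .or p q c := by
      simp only [GGMKnockoff.level]
      field_simp
    rw [hb]
    refine (key .or).trans (le_of_eq ?_)
    have hlev : 0 ≤ GGMKnockoff.level .or p q c := by
      simp only [GGMKnockoff.level]
      positivity
    rw [GGMKnockoff.ruleWeight, one_mul, ← ENNReal.ofReal_natCast p,
      ← ENNReal.ofReal_mul (by positivity), ← ENNReal.ofReal_mul (by positivity)]
    congr 1
    simp only [GGMKnockoff.level]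
    field_simp
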